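/- Let $\alpha_1,\alpha_2\ge 0$ with $\alpha:=\alpha_1+\alpha_2/2>0$, and let $\epsilon_1,\epsilon_5>0$ be constants independent of $n$, small enough that $(1-\epsilon_1)\sqrt{\alpha}-\epsilon_5\ge 0$. For each $n$ let $m_1=m_1(n)$ and $m_2=m_2(n)$ be non-negative integers with $m_1/n\to\alpha_1$ and $m_2/n\to\alpha_2$ as $n\to\infty$ (in particular $m_i=\alpha_i n$ up to rounding), let $A\in\mathbb{R}^{m_1\times n}$ and $B\in\mathbb{R}^{m_2\times n}$ be random matrices all of whose entries, taken together, are i.i.d. standard normal, and let $c=c^{(n)}\in\mathbb{R}^n$ be a deterministic vector such that $C_{gl}:=\|c\|_2/\sqrt n$ is bounded in $n$. Put $f_{gl}(x)=c^Tx=\sum_{i=1}^n c_ix_i$ and $$\xi_h(f_{gl},A,B)=\min\{\,c^Tx : x\in\mathbb{R}^n,\ Ax=0,\ Bx\le 0,\ \|x\|_2\le 1\,\}.$$ Let $d_l=(1-\epsilon_1)\sqrt{\alpha}-\epsilon_5$ and $d_u=(1+\epsilon_1)\sqrt{\alpha}+\epsilon_5$, and define $$\xi_D^{(l)}(f_{lp})=\begin{cases}-\sqrt{1-d_l^2}\,\sqrt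 n,& d_l^2\le 1,\\ 0,&\text{otherwise,}\end{cases}\qquad \xi_D^{(u)}(f_{lp})=\begin{cases}-\sqrt{1-d_u^2}\,\sqrt n,& d_u^2\le 1,\\ 0,&\text{otherwise.}\end{cases}$$ Set $\xi_D^{(l)}(f_{gl})=C_{gl}\,\xi_D^{(l)}(f_{lp})$ and $\xi_D^{(u)}(f_{gl})=C_{gl}\,\xi_D^{(u)}(f_{lp})$. If $\alpha<1$ and $c^{(n)}\ne 0$ for all large $n$, then $$\lim_{n\to\infty}P\big(\xi_D^{(l)}(f_{gl})<\xi_h(f_{gl},A,B)<\xi_D^{(u)}(f_{gl})\big)=1.$$ Without these two additional assumptions (in particular also for $\alpha\ge 1$), $$\lim_{n\to\infty}P\big(\xi_D^{(l)}(f_{gl})\le\xi_h(f_{gl},A,B)\le\xi_D^{(u)}(f_{gl})\big)=1.$$ -/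

import Mathlib

open Filter Topology MeasureTheory ProbabilityTheory
open scoped Matrix

noncomputable section

namespace RandomProgram

/-- The feasible set `{x ∈ ℝⁿ : A x = 0, B x ≤ 0, ‖x‖₂ ≤ 1}`. -/
def feasible {m₁ m₂ n : ℕ} (A : Matrix (Fin m₁) (Fin n) ℝ) (B : Matrix (Fin m₂) (Fin n) ℝ) :
    Set (EuclideanSpace ℝ (Fin n)) :=
  {x | A *ᵥ x.ofLp = 0 ∧ (∀ i, (B *ᵥ x.ofLp) i ≤ 0) ∧ ‖x‖ ≤ 1}

/-- The optimal value `ξ_h(f, A, B)` of minimizing `f` over the feasible set. -/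
def xiH {m₁ m₂ n : ℕ} (f : EuclideanSpace ℝ (Fin n) → ℝ)
    (A : Matrix (Fin m₁) (Fin n) ℝ) (B : Matrix (Fin m₂) (Fin n) ℝ) : ℝ :=
  sInf (f '' feasible A B)

/-- For a continuous objective the infimum in `xiH` is an attained minimum. -/
theorem isLeast_xiH {m₁ m₂ n : ℕ} {f : EuclideanSpace ℝ (Fin n) → ℝ} (hf : Continuous f)
    (A : Matrix (Fin m₁) (Fin n) ℝ) (B : Matrix (Fin m₂) (Fin n) ℝ) :
    IsLeast (f '' feasible A B) (xiH f A B) := by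
  have hne : (feasible A B).Nonempty := ⟨0, by simp [feasible]⟩
  have hA : Continuous fun x : EuclideanSpace ℝ (Fin n) => A *ᵥ x.ofLp :=
    continuous_const.matrix_mulVec (PiLp.continuous_ofLp 2 _)
  have hB : Continuous fun x : EuclideanSpace ℝ (Fin n) => B *ᵥ x.ofLp :=
    continuous_const.matrix_mulVec (PiLp.continuous_ofLp 2 _)
  have hcl : IsClosed (feasible A B) := by
    refine (isClosed_eq hA continuous_const).inter (IsClosed.inter ?_ ?_)
    · have : {x : EuclideanSpace ℝ (Fin n) | ∀ i, (B *ᵥ x.ofLp) i ≤ 0} =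
          ⋂ i, {x | (B *ᵥ x.ofLp) i ≤ 0} := by ext; simp
      change IsClosed {x : EuclideanSpace ℝ (Fin n) | ∀ i, (B *ᵥ x.ofLp) i ≤ 0}
      rw [this]
      exact isClosed_iInter fun i =>
        isClosed_le ((continuous_apply i).comp hB) continuous_const
    · exact isClosed_le continuous_norm continuous_const
  have hcpt : IsCompact (feasible A B) :=
    (isCompact_closedBall (0 : EuclideanSpace ℝ (Fin n)) 1).of_isClosed_subset hcl
      fun x hx => by simpa using hx.2.2
  exact (hcpt.image hf).isLeast_sInf (hne.image f)

/-- The general linear objective `f_gl(x) = ∑ᵢ cᵢ xᵢ`. -/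
def fgl {n : ℕ} (c : EuclideanSpace ℝ (Fin n)) (x : EuclideanSpace ℝ (Fin n)) : ℝ :=
  ∑ i, c i * x i

/-- The constant `C_gl = ‖c‖₂ / √n`. -/
def Cgl {n : ℕ} (c : EuclideanSpace ℝ (Fin n)) : ℝ := ‖c‖ / √(n : ℝ)

/-- `√D⁽ˡ⁾ = (1 - ε₁) √(α₁ + α₂/2) - ε₅`. -/
def sqrtDl (α₁ α₂ ε₁ ε₅ : ℝ) : ℝ := (1 - ε₁) * √(α₁ + α₂ / 2) - ε₅

/-- `√D⁽ᵘ⁾ = (1 + ε₁) √(α₁ + α₂/2) + ε₅`. -/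
def sqrtDu (α₁ α₂ ε₁ ε₅ : ℝ) : ℝ := (1 + ε₁) * √(α₁ + α₂ / 2) + ε₅

open Classical in
/-- The lower threshold `ξ_D⁽ˡ⁾(f_lp)` for the purely linear objective `∑ᵢ xᵢ`. -/
def xiDl (α₁ α₂ ε₁ ε₅ : ℝ) (n : ℕ) : ℝ :=
  if sqrtDl α₁ α₂ ε₁ ε₅ ^ 2 ≤ 1 then -√(1 - sqrtDl α₁ α₂ ε₁ ε₅ ^ 2) * √(n : ℝ) else 0

open Classical in
/-- The upper threshold `ξ_D⁽ᵘ⁾(f_lp)` for the purely linear objective `∑ᵢ xᵢ`. -/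
def xiDu (α₁ α₂ ε₁ ε₅ : ℝ) (n : ℕ) : ℝ :=
  if sqrtDu α₁ α₂ ε₁ ε₅ ^ 2 ≤ 1 then -√(1 - sqrtDu α₁ α₂ ε₁ ε₅ ^ 2) * √(n : ℝ) else 0

/-- All entries of the random matrices `A` and `B` together are i.i.d. standard normal. -/
structure IsStdGaussianPair {Ω : Type*} [MeasurableSpace Ω] (P : Measure Ω) {m₁ m₂ n : ℕ}
    (A : Ω → Matrix (Fin m₁) (Fin n) ℝ) (B : Ω → Matrix (Fin m₂) (Fin n) ℝ) : Prop where
  lawA : ∀ i j, HasLaw (fun ω => A ω i j) (gaussianReal 0 1) P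
  lawB : ∀ i j, HasLaw (fun ω => B ω i j) (gaussianReal 0 1) P
  indep : iIndepFun
    (fun (k : (Fin m₁ × Fin n) ⊕ (Fin m₂ × Fin n)) (ω : Ω) =>
      Sum.elim (fun p : Fin m₁ × Fin n => A ω p.1 p.2)
        (fun p : Fin m₂ × Fin n => B ω p.1 p.2) k) P

end RandomProgram

end

/-! The optimal value is `-‖p‖`, where `p` is the metric projection of `-c` on the polyhedral cone
cut out by the rows of `A` and `B` (`xiH_eq_neg_norm`). So it suffices to show that `‖p‖²` is close
to `(1 - α)‖c‖²`, or that `p = 0` when `α > 1`. This is done by an exact symmetry argument and two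
second-moment bounds.

If `p ≠ 0` and the rows are generic, `p` lies in the relative interior of one face. It equals the
residual of `-c` after projecting out all equality rows and the set `S` of active inequality rows,
with strictly positive multipliers (`FaceEvent`). Flipping the signs of inequality rows preserves
the Gaussian law and does not change any residual. For each `S` with nonzero residual, exactly one
of the `2 ^ m₂` sign patterns makes `S` the active set. Hence, away from zero, `p` is distributed as
the residual for a uniformly random `S` (`two_pow_mul_measureReal_isConeProj`).

Under the uniform law `|S|` is within `o(n)` of `m₂ / 2` by Chebyshev. For fixed `S` the residual is
the projection on a rotation-invariant subspace, almost surely of dimension `n - m₁ - |S|`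
(truncated at zero). Its squared norm concentrates at the corresponding fraction of `‖c‖²`
(`measureReal_norm_sq_res_dev_le`): by rotation invariance the vector may be replaced by a random
sign vector, and the variance of the resulting Rademacher chaos is at most twice the ambient
dimension. The thresholds lie strictly on either side of `α`, so the failure probabilities are
`O(1/n)`. -/

namespace RandomProgram

open scoped RealInnerProductSpace

/-! ### Residuals of orthogonal projection -/

section Residual

variable {ι E : Type*} [NormedAddCommGroup E] [InnerProductSpace ℝ E]

/-- The orthogonal complement of the vectors `v i`, `i ∈ T`. -/
noncomputable def annih (v : ι → E) (T : Finset ι) : Submodule ℝ E :=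
  (Submodule.span ℝ (v '' T))ᗮ

theorem mem_annih {v : ι → E} {T : Finset ι} {x : E} :
    x ∈ annih v T ↔ ∀ i ∈ T, ⟪v i, x⟫ = 0 := by
  rw [annih, Submodule.mem_orthogonal]
  constructor
  · intro h i hi
    exact h _ (Submodule.subset_span ⟨i, by simpa using hi, rfl⟩)
  · intro h u hu
    induction hu using Submodule.span_induction with
    | mem u hu => obtain ⟨i, hi, rfl⟩ := hu; exact h i (by simpa using hi)
    | zero => simp
    | add u w _ _ hu hw => rw [inner_add_left, hu, hw, add_zero]
    | smul a u _ hu => rw [inner_smul_left, hu, mul_zero]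

theorem annih_anti {v : ι → E} {S T : Finset ι} (h : S ⊆ T) : annih v T ≤ annih v S :=
  fun _ hx => mem_annih.2 fun i hi => mem_annih.1 hx i (h hi)

variable [FiniteDimensional ℝ E]

/-- The residual of `x` after projecting out the vectors `v i`, `i ∈ T`. -/
noncomputable def res (v : ι → E) (T : Finset ι) (x : E) : E :=
  (annih v T).starProjection x

theorem res_mem (v : ι → E) (T : Finset ι) (x : E) : res v T x ∈ annih v T :=
  Submodule.starProjection_apply_mem _ _

theorem inner_res_eq_zero (v : ι → E) {T : Finset ι} (x : E) {i : ι} (hi : i ∈ T) :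
    ⟪v i, res v T x⟫ = 0 :=
  mem_annih.1 (res_mem v T x) i hi

theorem inner_sub_res (v : ι → E) (T : Finset ι) (x : E) {y : E} (hy : y ∈ annih v T) :
    ⟪x - res v T x, y⟫ = 0 :=
  Submodule.starProjection_inner_eq_zero _ _ hy

theorem res_inner_comm (v : ι → E) (T : Finset ι) (x y : E) :
    ⟪res v T x, y⟫ = ⟪x, res v T y⟫ :=
  Submodule.inner_starProjection_left_eq_right _ _ _

theorem inner_res_self (v : ι → E) (T : Finset ι) (x : E) :
    ⟪x, res v T x⟫ = ‖res v T x‖ ^ 2 := by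
  have := inner_sub_res v T x (res_mem v T x)
  rw [inner_sub_left, real_inner_self_eq_norm_sq] at this
  linarith

theorem eq_res {v : ι → E} {T : Finset ι} {x p : E} (hp : p ∈ annih v T)
    (h : ∀ y ∈ annih v T, ⟪x - p, y⟫ = 0) : res v T x = p :=
  Submodule.eq_starProjection_of_mem_of_inner_eq_zero hp h

theorem res_eq_self {v : ι → E} {T : Finset ι} {x : E} (hx : x ∈ annih v T) : res v T x = x :=
  Submodule.starProjection_eq_self_iff.2 hx

theorem res_smul (v : ι → E) (T : Finset ι) (a : ℝ) (x : E) :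
    res v T (a • x) = a • res v T x := map_smul _ _ _

theorem norm_res_le_of_subset (v : ι → E) {S T : Finset ι} (h : S ⊆ T) (x : E) :
    ‖res v T x‖ ≤ ‖res v S x‖ := by
  have h1 : res v T (res v S x) = res v T x := by
    refine (eq_res (res_mem v T x) fun y hy => ?_)
    have a := inner_sub_res v S x (annih_anti h hy)
    have b := inner_sub_res v T x hy
    rw [inner_sub_left] at a b ⊢
    linarith
  rw [← h1]
  exact Submodule.norm_starProjection_apply_le _ _

theorem exists_sub_res_eq_sum (v : ι → E) (T : Finset ι) (x : E) :
    ∃ l : ι → ℝ, x - res v T x = ∑ i ∈ T, l i • v i := by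
  have h : x - res v T x ∈ Submodule.span ℝ (v '' T) := by
    rw [← Submodule.orthogonal_orthogonal (Submodule.span ℝ (v '' T))]
    exact Submodule.sub_starProjection_mem_orthogonal _
  classical
  obtain ⟨l, hl⟩ := (Submodule.mem_span_image_finset_iff_exists_fun ℝ).1 h
  refine ⟨fun i => if h : i ∈ T then l ⟨i, h⟩ else 0, ?_⟩
  rw [← hl, ← Finset.sum_coe_sort T]
  exact Finset.sum_congr rfl fun i _ => by simp

/-- One Gram–Schmidt step. If `v j` already lies in the span, its residual is zero and the
correction term vanishes. The formula makes residuals measurable in the rows by induction on `T`. -/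
theorem res_insert [DecidableEq ι] (v : ι → E) (T : Finset ι) (j : ι) (x : E) :
    res v (insert j T) x = res v T x -
      (⟪res v T (v j), res v T x⟫ / ‖res v T (v j)‖ ^ 2) • res v T (v j) := by
  have hj : ∀ y ∈ annih v T, ⟪v j, y⟫ = ⟪res v T (v j), y⟫ := fun y hy => by
    have := inner_sub_res v T (v j) hy
    rw [inner_sub_left] at this; linarith
  refine eq_res (mem_annih.2 fun i hi => ?_) fun y hy => ?_
  · rcases Finset.mem_insert.1 hi with rfl | hi
    · rw [hj _ (sub_mem (res_mem _ _ _) (Submodule.smul_mem _ _ (res_mem _ _ _))),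
        inner_sub_right, inner_smul_right, real_inner_self_eq_norm_sq]
      by_cases h0 : res v T (v i) = 0
      · simp [h0]
      · have : ‖res v T (v i)‖ ^ 2 ≠ 0 := by simpa using h0
        rw [div_mul_cancel₀ _ this, sub_self]
    · rw [inner_sub_right, inner_smul_right, inner_res_eq_zero _ _ hi, inner_res_eq_zero _ _ hi]
      simp
  · have hyT := annih_anti (Finset.subset_insert j T) hy
    have h1 := inner_sub_res v T x hyT
    have h2 : ⟪res v T (v j), y⟫ = 0 := by
      rw [← hj y hyT]; exact mem_annih.1 hy j (Finset.mem_insert_self _ _)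
    rw [sub_sub_eq_add_sub, add_sub_right_comm, inner_add_left, h1, inner_smul_left, h2]
    simp

theorem res_empty (v : ι → E) (x : E) : res v ∅ x = x :=
  res_eq_self (mem_annih.2 (by simp))

theorem res_congr {v w : ι → E} {T : Finset ι} (h : ∀ i ∈ T, v i = w i) (x : E) :
    res v T x = res w T x := by
  have : v '' T = w '' T := Set.image_congr (by simpa using h)
  simp only [res, annih, this]

/-- Nonzero rescaling does not change the span. Applied to signs, this is what makes the symmetry
argument work. -/
theorem res_smul_units {v : ι → E} {T : Finset ι} {a : ι → ℝ} (ha : ∀ i, a i ≠ 0) (x : E) :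
    res (fun i => a i • v i) T x = res v T x := by
  have : annih (fun i => a i • v i) T = annih v T := by
    ext y; simp [mem_annih, inner_smul_left, ha]
  simp only [res, this]

theorem res_isometry (e : E ≃ₗᵢ[ℝ] E) (v : ι → E) (T : Finset ι) (x : E) :
    res (fun i => e (v i)) T (e x) = e (res v T x) := by
  refine eq_res (mem_annih.2 fun i hi => ?_) fun y hy => ?_
  · rw [e.inner_map_map, inner_res_eq_zero _ _ hi]
  · have hy' : e.symm y ∈ annih v T := mem_annih.2 fun i hi => by
      rw [← e.inner_map_map, e.apply_symm_apply]; exact mem_annih.1 hy i hi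
    rw [← inner_sub_res v T x hy', ← e.inner_map_map (x - _), e.apply_symm_apply, map_sub]

theorem measurable_res [MeasurableSpace E] [BorelSpace E] (T : Finset ι) :
    Measurable fun q : (ι → E) × E => res q.1 T q.2 := by
  classical
  induction T using Finset.induction_on with
  | empty => simpa only [res_empty] using measurable_snd
  | insert j T _ ih =>
    simp only [res_insert]
    have hj : Measurable fun q : (ι → E) × E => res q.1 T (q.1 j) :=
      ih.comp (measurable_fst.prodMk ((measurable_pi_apply j).comp measurable_fst))
    exact ih.sub (((hj.inner ih).div (hj.norm.pow_const 2)).smul hj)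

theorem measurable_res_left [MeasurableSpace E] [BorelSpace E] (T : Finset ι) (x : E) :
    Measurable fun v : ι → E => res v T x :=
  Measurable.of_uncurry_right (f := fun v x => res v T x) (measurable_res T)

end Residual

/-! ### Projection on a polyhedral cone and its faces -/

section Cone

variable {κ ι E : Type*} [NormedAddCommGroup E] [InnerProductSpace ℝ E]

/-- The polyhedral cone cut out by the equalities `⟪v (inl k), x⟫ = 0` and the inequalities
`⟪v (inr i), x⟫ ≤ 0`. -/
def polyCone (v : κ ⊕ ι → E) : Set E :=
  {x | (∀ k, ⟪v (.inl k), x⟫ = 0) ∧ ∀ i, ⟪v (.inr i), x⟫ ≤ 0}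

/-- The variational characterization of `p` being the metric projection of `x` on `polyCone v`. -/
structure IsConeProj (v : κ ⊕ ι → E) (x p : E) : Prop where
  mem : p ∈ polyCone v
  inner_self : ⟪x - p, p⟫ = 0
  inner_le : ∀ y ∈ polyCone v, ⟪x - p, y⟫ ≤ 0

theorem IsConeProj.unique {v : κ ⊕ ι → E} {x p q : E} (hp : IsConeProj v x p)
    (hq : IsConeProj v x q) : p = q := by
  have h1 := hp.inner_le q hq.mem
  have h2 := hq.inner_le p hp.mem
  have h3 := hp.inner_self
  have h4 := hq.inner_self
  have : ⟪p - q, p - q⟫ ≤ 0 := by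
    simp only [inner_sub_left, inner_sub_right] at *
    have := real_inner_comm p q
    linarith
  have := le_antisymm this real_inner_self_nonneg
  exact sub_eq_zero.1 (inner_self_eq_zero.1 this)

theorem smul_mem_polyCone {v : κ ⊕ ι → E} {x : E} (hx : x ∈ polyCone v) {a : ℝ} (ha : 0 ≤ a) :
    a • x ∈ polyCone v :=
  ⟨fun k => by rw [inner_smul_right, hx.1 k, mul_zero],
    fun i => by rw [inner_smul_right]; exact mul_nonpos_of_nonneg_of_nonpos ha (hx.2 i)⟩

theorem zero_mem_polyCone (v : κ ⊕ ι → E) : (0 : E) ∈ polyCone v := by simp [polyCone]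

theorem exists_isConeProj [CompleteSpace E] (v : κ ⊕ ι → E) (x : E) :
    ∃ p, IsConeProj v x p := by
  have hconv : Convex ℝ (polyCone v) := by
    intro y hy z hz a b ha hb _
    refine ⟨fun k => ?_, fun i => ?_⟩
    · rw [inner_add_right, inner_smul_right, inner_smul_right, hy.1 k, hz.1 k]; simp
    · rw [inner_add_right, inner_smul_right, inner_smul_right]
      exact add_nonpos (mul_nonpos_of_nonneg_of_nonpos ha (hy.2 i))
        (mul_nonpos_of_nonneg_of_nonpos hb (hz.2 i))
  have hcl : IsClosed (polyCone v) := by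
    have : polyCone v = (⋂ k, {x | ⟪v (.inl k), x⟫ = 0}) ∩ ⋂ i, {x | ⟪v (.inr i), x⟫ ≤ 0} := by
      ext; simp [polyCone]
    rw [this]
    exact (isClosed_iInter fun k => isClosed_eq (by fun_prop) continuous_const).inter
      (isClosed_iInter fun i => isClosed_le (by fun_prop) continuous_const)
  obtain ⟨p, hp, hmin⟩ := exists_norm_eq_iInf_of_complete_convex
    ⟨0, zero_mem_polyCone v⟩ hcl.isComplete hconv x
  have key := (norm_eq_iInf_iff_real_inner_le_zero hconv hp).1 hmin
  have h0 : ⟪x - p, p⟫ = 0 := by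
    have a := key 0 (zero_mem_polyCone v)
    have b := key ((2 : ℝ) • p) (smul_mem_polyCone hp (by norm_num))
    rw [inner_sub_right, inner_zero_right] at a
    rw [inner_sub_right, inner_smul_right] at b
    linarith
  refine ⟨p, hp, h0, fun y hy => ?_⟩
  have := key y hy
  rwa [inner_sub_right, h0, sub_zero] at this

theorem exists_pos_add_smul_mem_polyCone [Finite ι] {v : κ ⊕ ι → E} {p y : E}
    (hp : p ∈ polyCone v) (hk : ∀ k, ⟪v (.inl k), y⟫ = 0)
    (hi : ∀ i, ⟪v (.inr i), p⟫ = 0 → ⟪v (.inr i), y⟫ ≤ 0) :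
    ∃ t : ℝ, 0 < t ∧ p + t • y ∈ polyCone v := by
  have : ∀ᶠ t in 𝓝[>] (0 : ℝ), ∀ i, ⟪v (.inr i), p + t • y⟫ ≤ 0 := by
    rw [Filter.eventually_all]
    intro i
    rcases (hp.2 i).lt_or_eq with h | h
    · have hc : ContinuousAt (fun t : ℝ => ⟪v (.inr i), p + t • y⟫) 0 := by fun_prop
      have : ∀ᶠ t in 𝓝 (0 : ℝ), ⟪v (.inr i), p + t • y⟫ < 0 :=
        hc.eventually_lt continuousAt_const (by simpa using h)
      exact (this.filter_mono nhdsWithin_le_nhds).mono fun _ h => h.le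
    · filter_upwards [self_mem_nhdsWithin] with t ht
      rw [inner_add_right, h, inner_smul_right, zero_add]
      exact mul_nonpos_of_nonneg_of_nonpos (le_of_lt ht) (hi i h)
  obtain ⟨t, ht, htp⟩ := (this.and self_mem_nhdsWithin).exists
  refine ⟨t, htp, fun k => ?_, ht⟩
  rw [inner_add_right, inner_smul_right, hp.1 k, hk k]; simp

/-- The optimality condition extends from the cone to its tangent cone at `p`: inactive constraints
stay satisfied along a short step, so only active ones restrict `y`. -/
theorem IsConeProj.inner_tangent_le [Finite ι] {v : κ ⊕ ι → E} {x p y : E}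
    (hp : IsConeProj v x p) (hk : ∀ k, ⟪v (.inl k), y⟫ = 0)
    (hi : ∀ i, ⟪v (.inr i), p⟫ = 0 → ⟪v (.inr i), y⟫ ≤ 0) : ⟪x - p, y⟫ ≤ 0 := by
  obtain ⟨t, ht, hmem⟩ := exists_pos_add_smul_mem_polyCone hp.mem hk hi
  have := hp.inner_le _ hmem
  rw [inner_add_right, hp.inner_self, inner_smul_right, zero_add] at this
  exact nonpos_of_mul_nonpos_right this ht

variable [Fintype κ] [FiniteDimensional ℝ E]

/-- The rows that vanish on the face with active inequalities `S`. -/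
def faceRows (κ : Type*) [Fintype κ] (S : Finset ι) : Finset (κ ⊕ ι) := Finset.univ.disjSum S

/-- The projection of `x` on the cone is the relative interior point `res v (faceRows κ S) x`
of the face with active inequalities `S`, and all multipliers are positive. -/
def FaceEvent [DecidableEq ι] (v : κ ⊕ ι → E) (x : E) (S : Finset ι) : Prop :=
  res v (faceRows κ S) x ≠ 0 ∧
  (∀ j ∉ S, ⟪v (.inr j), res v (faceRows κ S) x⟫ < 0) ∧
  ∀ i ∈ S, 0 < ⟪v (.inr i), res v (faceRows κ (S.erase i)) x⟫

@[simp] theorem inl_mem_faceRows {S : Finset ι} (k : κ) : .inl k ∈ faceRows κ S := by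
  simp [faceRows]

@[simp] theorem inr_mem_faceRows {S : Finset ι} (i : ι) :
    .inr i ∈ faceRows κ S ↔ i ∈ S := by
  simp [faceRows]

theorem faceRows_mono {S T : Finset ι} (h : S ⊆ T) : faceRows κ S ⊆ faceRows κ T := by
  rintro (k | i) hi
  · simp
  · rw [inr_mem_faceRows] at *; exact h hi

/-- Sufficiency of the KKT conditions: `x - p` is a combination of the face rows whose coefficients
on the inequality rows are nonnegative. -/
theorem FaceEvent.isConeProj [DecidableEq ι] {v : κ ⊕ ι → E} {x : E} {S : Finset ι}
    (h : FaceEvent v x S) : IsConeProj v x (res v (faceRows κ S) x) := by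
  set p := res v (faceRows κ S) x with hp
  obtain ⟨l, hl⟩ := exists_sub_res_eq_sum v (faceRows κ S) x
  rw [← hp] at hl
  have hlpos : ∀ i ∈ S, 0 ≤ l (.inr i) := by
    intro i hi
    set T := faceRows κ (S.erase i) with hT
    -- Pairing `x - p` with the part of `v (.inr i)` orthogonal to the other face rows isolates the
    -- multiplier of row `i`.
    set w := res v T (v (.inr i)) with hw
    have hpos := h.2.2 i hi
    rw [← hT, ← res_inner_comm, ← hw] at hpos
    have hpw : ⟪p, w⟫ = 0 := by
      rw [hw, ← res_inner_comm, res_eq_self (annih_anti (faceRows_mono (Finset.erase_subset i S))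
        (res_mem _ _ _)), real_inner_comm]
      exact inner_res_eq_zero _ _ (by simpa using hi)
    have hsum : ⟪x - p, w⟫ = l (.inr i) * ‖w‖ ^ 2 := by
      rw [hl, sum_inner, Finset.sum_eq_single (.inr i)]
      · rw [inner_smul_left, hw, inner_res_self]; simp
      · intro j hj hji
        have hjT : j ∈ T := by
          rcases j with k | j
          · simp [hT]
          · simp only [hT, inr_mem_faceRows, Finset.mem_erase] at *
            exact ⟨fun h => hji (by rw [h]), hj⟩
        rw [inner_smul_left, inner_res_eq_zero _ _ hjT, mul_zero]
      · intro hn; exact absurd (by simpa using hi) hn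
    rw [inner_sub_left, hpw, sub_zero, real_inner_comm] at hsum
    have hw0 : 0 ≤ ‖w‖ ^ 2 := by positivity
    by_contra hneg
    push Not at hneg
    nlinarith
  refine ⟨⟨fun k => inner_res_eq_zero _ _ (by simp), fun i => ?_⟩,
    inner_sub_res _ _ _ (res_mem _ _ _), fun y hy => ?_⟩
  · by_cases hi : i ∈ S
    · exact (inner_res_eq_zero v x (by simpa using hi)).le
    · exact (h.2.1 i hi).le
  · rw [hl, sum_inner]
    refine Finset.sum_nonpos fun i hi => ?_
    rw [inner_smul_left]
    rcases i with k | i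
    · rw [hy.1 k, mul_zero]
    · exact mul_nonpos_of_nonneg_of_nonpos (hlpos i (by simpa using hi)) (hy.2 i)

/-- The projection is unique, and `S` is recovered from it as the set of active inequalities. -/
theorem FaceEvent.unique [DecidableEq ι] {v : κ ⊕ ι → E} {x : E} {S T : Finset ι}
    (hS : FaceEvent v x S) (hT : FaceEvent v x T) : S = T := by
  have hpq := hS.isConeProj.unique hT.isConeProj
  ext i
  constructor
  · intro hi
    by_contra hn
    have := hT.2.1 i hn
    rw [← hpq, inner_res_eq_zero v x (by simpa using hi)] at this
    exact this.false
  · intro hi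
    by_contra hn
    have := hS.2.1 i hn
    rw [hpq, inner_res_eq_zero v x (by simpa using hi)] at this
    exact this.false

/-- No residual of `x` is orthogonal to a row that was not projected out, unless it vanishes. -/
def IsGeneric {ι : Type*} (v : ι → E) (x : E) : Prop :=
  ∀ (T : Finset ι), ∀ j ∉ T, res v T x ≠ 0 → ⟪v j, res v T x⟫ ≠ 0

/-- Take `S` to be the active set at `p`. Directions inside the face are tangent with both signs, so
`p` is the residual. Genericity upgrades the multiplier conditions to strict ones. -/
theorem IsConeProj.exists_faceEvent [Fintype ι] [DecidableEq ι] {v : κ ⊕ ι → E} {x p : E}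
    (hp : IsConeProj v x p) (hp0 : p ≠ 0) (hgen : IsGeneric v x) :
    ∃ S, FaceEvent v x S ∧ p = res v (faceRows κ S) x := by
  classical
  set S : Finset ι := Finset.univ.filter fun i => ⟪v (.inr i), p⟫ = 0 with hS
  have hmemS : ∀ i, i ∈ S ↔ ⟪v (.inr i), p⟫ = 0 := by simp [hS]
  have hpS : p ∈ annih v (faceRows κ S) := by
    rw [mem_annih]
    rintro (k | i) h
    · exact hp.mem.1 k
    · exact (hmemS i).1 (by simpa using h)
  have hres : res v (faceRows κ S) x = p := by
    refine eq_res hpS fun y hy => ?_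
    have key : ∀ y ∈ annih v (faceRows κ S), ⟪x - p, y⟫ ≤ 0 := fun y hy =>
      hp.inner_tangent_le (fun k => mem_annih.1 hy _ (by simp))
        fun i hi => (mem_annih.1 hy _ (by simpa using (hmemS i).2 hi)).le
    have h1 := key y hy
    have h2 := key (-y) (neg_mem hy)
    rw [inner_neg_right] at h2
    linarith
  refine ⟨S, ⟨by rwa [hres], fun j hj => ?_, fun i hi => ?_⟩, hres.symm⟩
  · rw [hres]
    exact lt_of_le_of_ne (hp.mem.2 j) fun h => hj ((hmemS j).2 h)
  · have hsub := faceRows_mono (κ := κ) (Finset.erase_subset i S)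
    set T := faceRows κ (S.erase i) with hT
    have hq0 : res v T x ≠ 0 := by
      have := norm_res_le_of_subset v hsub x
      rw [hres] at this
      exact norm_pos_iff.1 ((norm_pos_iff.2 hp0).trans_le this)
    have hne := hgen T (.inr i) (by simp [hT]) hq0
    by_contra hneg
    have hlt : ⟪v (.inr i), res v T x⟫ < 0 := lt_of_le_of_ne (not_lt.1 hneg) hne
    -- If the multiplier of row `i` had the wrong sign, releasing that row would give a tangent
    -- direction `y` with `⟪x - p, y⟫ = ‖y‖²`. This forces `y = 0`, so row `i` would be orthogonal
    -- to the residual after all.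
    set y := res v T x - p with hy
    have hyT : y ∈ annih v T := sub_mem (res_mem _ _ _) (annih_anti hsub hpS)
    have hle : ⟪x - p, y⟫ ≤ 0 := by
      refine hp.inner_tangent_le (fun k => mem_annih.1 hyT _ (by simp [hT])) fun j hj => ?_
      by_cases hji : j = i
      · subst hji
        rw [hy, inner_sub_right, hj, sub_zero]; exact hlt.le
      · exact (mem_annih.1 hyT _ (by
          rw [hT, inr_mem_faceRows]; exact Finset.mem_erase.2 ⟨hji, (hmemS j).2 hj⟩)).le
    have h0 := inner_sub_res v T x hyT
    have : ⟪y, y⟫ ≤ 0 := by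
      have e : x - p = (x - res v T x) + y := by rw [hy]; abel
      rwa [e, inner_add_left, h0, zero_add] at hle
    have hy0 : y = 0 := inner_self_eq_zero.1 (le_antisymm this real_inner_self_nonneg)
    rw [sub_eq_zero.1 hy0, (hmemS i).1 hi] at hlt
    exact hlt.false

end Cone

/-! ### Moments of random signs and uniform random subsets -/

section Signs

variable {ι : Type*} [DecidableEq ι]

/-- The sign vector attached to a finite set `s`: `-1` on `s` and `1` off `s`. -/
def sgn (s : Finset ι) (i : ι) : ℝ := if i ∈ s then -1 else 1

theorem sgn_ne_zero (s : Finset ι) (i : ι) : sgn s i ≠ 0 := by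
  unfold sgn; split_ifs <;> norm_num

theorem sgn_mul_self (s : Finset ι) (i : ι) : sgn s i * sgn s i = 1 := by
  unfold sgn; split_ifs <;> norm_num

theorem sgn_symmDiff_self (s : Finset ι) (a : ι) : sgn (symmDiff s {a}) a = -sgn s a := by
  by_cases h : a ∈ s <;> simp [sgn, Finset.mem_symmDiff, h]

theorem sgn_symmDiff_of_ne (s : Finset ι) {a b : ι} (h : b ≠ a) :
    sgn (symmDiff s {a}) b = sgn s b := by
  by_cases hb : b ∈ s <;> simp [sgn, Finset.mem_symmDiff, h, hb]

variable [Fintype ι]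

/-- Flipping the sign at `a` is an involution of the index set. -/
theorem sum_eq_zero_of_symmDiff_neg (f : Finset ι → ℝ) (a : ι)
    (h : ∀ s, f (symmDiff s {a}) = -f s) : ∑ s, f s = 0 := by
  have e : ∑ s, f (symmDiff s {a}) = ∑ s, f s :=
    Equiv.sum_comp (symmDiff_left_involutive ({a} : Finset ι)).toPerm f
  simp only [h, Finset.sum_neg_distrib] at e
  linarith

theorem sum_sgn_mul_sgn (i j : ι) :
    ∑ s, sgn s i * sgn s j = if i = j then (2 : ℝ) ^ Fintype.card ι else 0 := by
  split_ifs with h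
  · subst h; simp [sgn_mul_self]
  · refine sum_eq_zero_of_symmDiff_neg _ i fun s => ?_
    rw [sgn_symmDiff_self, sgn_symmDiff_of_ne _ (Ne.symm h), neg_mul]

theorem sum_sq_sum {σ τ : Type*} [Fintype σ] [Fintype τ] (f : σ → τ → ℝ) :
    ∑ s, (∑ p, f s p) ^ 2 = ∑ p, ∑ q, ∑ s, f s p * f s q := by
  simp only [sq, Finset.sum_mul_sum]
  rw [Finset.sum_comm]
  exact Finset.sum_congr rfl fun p _ => Finset.sum_comm

theorem sum_sq_sum_sgn :
    ∑ s : Finset ι, (∑ i, sgn s i) ^ 2 = (2 : ℝ) ^ Fintype.card ι * Fintype.card ι := by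
  rw [sum_sq_sum]
  simp only [sum_sgn_mul_sgn]
  simp [mul_comm]

/-- A product of signs averages to zero unless every index occurs an even number of times; with `i ≠
j` only the two pairings survive. -/
theorem sum_sgn_four {i j k l : ι} (hij : i ≠ j) :
    ∑ s, (sgn s i * sgn s j) * (sgn s k * sgn s l) =
      2 ^ Fintype.card ι *
        ((if k = i ∧ l = j then (1 : ℝ) else 0) + if l = i ∧ k = j then (1 : ℝ) else 0) := by
  by_cases h1 : k = i ∧ l = j
  · obtain ⟨rfl, rfl⟩ := h1
    have e : ∀ s, (sgn s k * sgn s l) * (sgn s k * sgn s l) = 1 := fun s => by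
      rw [mul_mul_mul_comm, sgn_mul_self, sgn_mul_self, one_mul]
    simp [e, hij]
  by_cases h2 : l = i ∧ k = j
  · obtain ⟨rfl, rfl⟩ := h2
    have e : ∀ s, (sgn s l * sgn s k) * (sgn s k * sgn s l) = 1 := fun s => by
      rw [mul_comm (sgn s k), mul_mul_mul_comm, sgn_mul_self, sgn_mul_self, one_mul]
    simp [e, hij]
  rw [if_neg h1, if_neg h2, add_zero, mul_zero]
  -- Choose an index occurring exactly once, so that flipping its sign negates the product: `j` if
  -- `i` is matched, otherwise `i`.
  by_cases hi : i = k ∨ i = l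
  · have hjk : k ≠ j := by
      rintro rfl
      rcases hi with h | h
      · exact hij h
      · exact h2 ⟨h.symm, rfl⟩
    have hjl : l ≠ j := by
      rintro rfl
      rcases hi with h | h
      · exact h1 ⟨h.symm, rfl⟩
      · exact hij h
    refine sum_eq_zero_of_symmDiff_neg _ j fun s => ?_
    rw [sgn_symmDiff_self, sgn_symmDiff_of_ne _ hij, sgn_symmDiff_of_ne _ hjk,
      sgn_symmDiff_of_ne _ hjl]
    ring
  · push Not at hi
    refine sum_eq_zero_of_symmDiff_neg _ i fun s => ?_
    rw [sgn_symmDiff_self, sgn_symmDiff_of_ne _ hij.symm, sgn_symmDiff_of_ne _ hi.1.symm,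
      sgn_symmDiff_of_ne _ hi.2.symm]
    ring

/-- The variance of a Rademacher chaos of order two. -/
theorem sum_sq_chaos_le (M : ι → ι → ℝ) (hM : ∀ i j, M i j = M j i) :
    ∑ s : Finset ι, ((∑ i, ∑ j, M i j * (sgn s i * sgn s j)) - ∑ i, M i i) ^ 2 ≤
      2 ^ Fintype.card ι * (2 * ∑ i, ∑ j, M i j ^ 2) := by
  set N : ι → ι → ℝ := fun i j => if i = j then 0 else M i j with hN
  have hdiag : ∀ s : Finset ι, (∑ i, ∑ j, M i j * (sgn s i * sgn s j)) - ∑ i, M i i =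
      ∑ p : ι × ι, N p.1 p.2 * (sgn s p.1 * sgn s p.2) := by
    intro s
    rw [Fintype.sum_prod_type, ← Finset.sum_sub_distrib]
    refine Finset.sum_congr rfl fun i _ => ?_
    rw [← Finset.add_sum_erase _ _ (Finset.mem_univ i),
      ← Finset.add_sum_erase _ (fun j => N i j * _) (Finset.mem_univ i), sgn_mul_self]
    have : ∑ j ∈ Finset.univ.erase i, M i j * (sgn s i * sgn s j) =
        ∑ j ∈ Finset.univ.erase i, N i j * (sgn s i * sgn s j) :=
      Finset.sum_congr rfl fun j hj => by rw [hN]; simp [(Finset.ne_of_mem_erase hj).symm]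
    rw [this]
    simp [hN]
  -- Only `q = p` and `q = p.swap` contribute. By symmetry of `M` the two contributions agree, which
  -- is the source of the factor 2.
  have hterm : ∀ p q : ι × ι,
      ∑ s, (N p.1 p.2 * (sgn s p.1 * sgn s p.2)) * (N q.1 q.2 * (sgn s q.1 * sgn s q.2)) =
      2 ^ Fintype.card ι * ((if q = p then N p.1 p.2 * N q.1 q.2 else 0) +
        if q = p.swap then N p.1 p.2 * N q.1 q.2 else 0) := by
    rintro ⟨i, j⟩ ⟨k, l⟩
    by_cases hij : i = j
    · simp [hN, hij]
    by_cases hkl : k = l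
    · simp [hN, hkl]
    have := sum_sgn_four (k := k) (l := l) hij
    simp only [Prod.mk.injEq, Prod.swap_prod_mk]
    calc _ = N i j * N k l * ∑ s, (sgn s i * sgn s j) * (sgn s k * sgn s l) := by
          rw [Finset.mul_sum]; exact Finset.sum_congr rfl fun s _ => by ring
      _ = _ := by
          rw [this]
          simp only [and_comm (a := l = i)]
          split_ifs <;> ring
  simp only [hdiag]
  rw [sum_sq_sum]
  simp only [hterm]
  simp only [← Finset.mul_sum, Finset.sum_add_distrib, Finset.sum_ite_eq', Finset.mem_univ,
    if_true, Prod.fst_swap, Prod.snd_swap]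
  have hsymm : ∀ p : ι × ι, N p.2 p.1 = N p.1 p.2 := fun p => by
    simp only [hN, eq_comm (a := p.2), hM p.2]
  simp only [hsymm, ← two_mul]
  rw [← Fintype.sum_prod_type']
  gcongr with p
  simp only [hN]
  split_ifs
  · simpa using sq_nonneg (M p.1 p.2)
  · exact (sq _).ge

theorem card_finset_sub_half (s : Finset ι) :
    (s.card : ℝ) - Fintype.card ι / 2 = -(∑ i, sgn s i) / 2 := by
  have : ∀ i, sgn s i = 1 - 2 * if i ∈ s then 1 else 0 := fun i => by
    unfold sgn; split_ifs <;> norm_num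
  simp only [this, Finset.sum_sub_distrib, ← Finset.mul_sum]
  simp
  ring

/-- The Chebyshev inequality for the size of a uniformly random subset. -/
theorem card_filter_card_sub_half_le {a : ℝ} (ha : 0 < a) :
    ((Finset.univ.filter fun s : Finset ι => a ≤ |(s.card : ℝ) - Fintype.card ι / 2|).card : ℝ)
      ≤ 2 ^ Fintype.card ι * (Fintype.card ι / (4 * a ^ 2)) := by
  have h1 : ∑ s : Finset ι, ((s.card : ℝ) - Fintype.card ι / 2) ^ 2 =
      (2 : ℝ) ^ Fintype.card ι * Fintype.card ι / 4 := by
    simp only [card_finset_sub_half, div_pow, neg_sq, ← Finset.sum_div, sum_sq_sum_sgn]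
    norm_num
  have h2 : ((Finset.univ.filter fun s : Finset ι =>
      a ≤ |(s.card : ℝ) - Fintype.card ι / 2|).card : ℝ) * a ^ 2 ≤
      ∑ s : Finset ι, ((s.card : ℝ) - Fintype.card ι / 2) ^ 2 := by
    rw [← nsmul_eq_mul]
    refine (Finset.card_nsmul_le_sum _ _ _ fun s hs => ?_).trans
      (Finset.sum_le_sum_of_subset_of_nonneg (Finset.subset_univ _) fun _ _ _ => sq_nonneg _)
    rw [← sq_abs (_ - _)]
    exact pow_le_pow_left₀ ha.le (Finset.mem_filter.1 hs).2 2
  rw [h1] at h2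
  rw [← le_div_iff₀ (by positivity)] at h2
  refine h2.trans (le_of_eq ?_)
  field_simp

end Signs

/-! ### Dimension of the complement as the trace of its projection -/

section Trace

variable {ι κ E : Type*} [NormedAddCommGroup E] [InnerProductSpace ℝ E]

theorem finrank_annih_isometry (e : E ≃ₗᵢ[ℝ] E) (v : ι → E) (T : Finset ι) :
    Module.finrank ℝ (annih (fun i => e (v i)) T) = Module.finrank ℝ (annih v T) := by
  have : annih (fun i => e (v i)) T = (annih v T).map (e.toLinearEquiv : E →ₗ[ℝ] E) := by
    ext y
    constructor
    · intro hy
      refine ⟨e.symm y, mem_annih.2 fun i hi => ?_, by simp⟩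
      rw [← e.inner_map_map, e.apply_symm_apply]; exact mem_annih.1 hy i hi
    · rintro ⟨x, hx, rfl⟩
      refine mem_annih.2 fun i hi => ?_
      have := mem_annih.1 hx i hi
      rw [← e.inner_map_map] at this
      exact this
  rw [this]
  exact LinearEquiv.finrank_map_eq e.toLinearEquiv _

variable [FiniteDimensional ℝ E] [Fintype κ]

theorem sum_norm_sq_res (b : OrthonormalBasis κ ℝ E) (v : ι → E) (T : Finset ι) :
    ∑ k, ‖res v T (b k)‖ ^ 2 = Module.finrank ℝ (annih v T) := by
  have h : LinearMap.IsProj (annih v T) ((annih v T).starProjection : E →ₗ[ℝ] E) :=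
    ⟨fun x => res_mem v T x, fun x hx => res_eq_self hx⟩
  rw [← h.trace, LinearMap.trace_eq_sum_inner _ b]
  exact Finset.sum_congr rfl fun k _ => (inner_res_self v T (b k)).symm

/-- The squared norm is the quadratic chaos of the projection matrix. Its trace and its squared
Frobenius norm both equal the dimension of the complement, at most `card κ`. -/
theorem sum_sq_norm_sq_res_sub_le [DecidableEq κ] (b : OrthonormalBasis κ ℝ E) (v : ι → E)
    (T : Finset ι) :
    ∑ s : Finset κ, (‖res v T (∑ k, sgn s k • b k)‖ ^ 2 - Module.finrank ℝ (annih v T)) ^ 2 ≤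
      2 ^ Fintype.card κ * (2 * Fintype.card κ) := by
  set M : κ → κ → ℝ := fun i j => ⟪b i, res v T (b j)⟫ with hM
  have hsymm : ∀ i j, M i j = M j i := fun i j => by
    simp only [hM]; rw [← res_inner_comm, real_inner_comm]
  have hquad : ∀ s : Finset κ, ‖res v T (∑ k, sgn s k • b k)‖ ^ 2 =
      ∑ i, ∑ j, M i j * (sgn s i * sgn s j) := by
    intro s
    have : res v T (∑ k, sgn s k • b k) = ∑ k, sgn s k • res v T (b k) := by
      simp only [res, map_sum, map_smul]
    rw [← inner_res_self, this, sum_inner]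
    refine Finset.sum_congr rfl fun i _ => ?_
    rw [inner_sum]
    refine Finset.sum_congr rfl fun j _ => ?_
    rw [inner_smul_left, inner_smul_right]
    simp only [hM, RCLike.conj_to_real]
    ring
  have htr : (Module.finrank ℝ (annih v T) : ℝ) = ∑ i, M i i := by
    rw [← sum_norm_sq_res b]
    exact Finset.sum_congr rfl fun k _ => (inner_res_self v T (b k)).symm
  have hfro : ∑ i, ∑ j, M i j ^ 2 ≤ Fintype.card κ := by
    rw [Finset.sum_comm]
    have : ∀ j, ∑ i, M i j ^ 2 = ‖res v T (b j)‖ ^ 2 := fun j => by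
      simp only [hM]
      rw [← b.sum_sq_norm_inner_right (res v T (b j))]
      exact Finset.sum_congr rfl fun i _ => by rw [Real.norm_eq_abs, sq_abs]
    simp only [this]
    rw [sum_norm_sq_res b, ← Module.finrank_eq_card_basis b.toBasis]
    exact_mod_cast Submodule.finrank_le _
  simp only [hquad, htr]
  refine (sum_sq_chaos_le M hsymm).trans ?_
  gcongr

theorem finrank_annih_ge (v : ι → E) (T : Finset ι) :
    Module.finrank ℝ E ≤ Module.finrank ℝ (annih v T) + T.card := by
  classical
  have h1 := Submodule.finrank_add_finrank_orthogonal (Submodule.span ℝ (v '' T))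
  have h2 : Module.finrank ℝ (Submodule.span ℝ (v '' T)) ≤ T.card := by
    have := finrank_span_finset_le_card (R := ℝ) (T.image v)
    rw [Finset.coe_image] at this
    exact this.trans Finset.card_image_le
  unfold annih
  omega

/-- While the complement is nonzero, some basis vector has a nonzero residual. A new row is not
orthogonal to it, so the dimension drops. The truncated subtraction covers more rows than
dimensions. -/
theorem finrank_annih_le_of_isGeneric (b : OrthonormalBasis κ ℝ E) {v : ι → E}
    (hv : ∀ k, IsGeneric v (b k)) (T : Finset ι) :
    Module.finrank ℝ (annih v T) ≤ Module.finrank ℝ E - T.card := by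
  classical
  induction T using Finset.induction_on with
  | empty => simpa using Submodule.finrank_le (annih v ∅)
  | insert j T hj ih =>
    rw [Finset.card_insert_of_notMem hj]
    have hle := annih_anti (v := v) (Finset.subset_insert j T)
    by_cases h0 : ∀ k, res v T (b k) = 0
    · have hz : (Module.finrank ℝ (annih v T) : ℝ) = 0 := by
        rw [← sum_norm_sq_res b]; simp [h0]
      have hz' : Module.finrank ℝ (annih v T) = 0 := by exact_mod_cast hz
      have := Submodule.finrank_mono hle
      omega
    · push Not at h0
      obtain ⟨k, hk⟩ := h0
      have hne := hv k T j hj hk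
      have hlt : annih v (insert j T) < annih v T :=
        lt_of_le_of_ne hle fun h => hne (mem_annih.1 (h ▸ res_mem v T (b k)) j (by simp))
      have := Submodule.finrank_lt_finrank_of_lt hlt
      omega

end Trace

/-! ### Gaussian rows: genericity, rotation invariance, concentration -/

section GaussianRows

variable {ι E : Type*} [Fintype ι] [NormedAddCommGroup E] [InnerProductSpace ℝ E]
  [FiniteDimensional ℝ E] [MeasurableSpace E] [BorelSpace E]

/-- The law of a family of independent standard Gaussian vectors. -/
noncomputable abbrev gaussRows (ι E : Type*) [Fintype ι] [NormedAddCommGroup E]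
    [InnerProductSpace ℝ E] [FiniteDimensional ℝ E] [MeasurableSpace E] [BorelSpace E] :
    Measure (ι → E) :=
  Measure.pi fun _ => stdGaussian E

theorem stdGaussian_inner_eq_zero {x : E} (hx : x ≠ 0) :
    stdGaussian E {w | ⟪w, x⟫ = 0} = 0 := by
  have h := IsGaussian.map_eq_gaussianReal (μ := stdGaussian E) (innerSL ℝ x)
  rw [variance_dual_stdGaussian, innerSL_apply_norm] at h
  have hv : (‖x‖ ^ 2).toNNReal ≠ 0 := by
    simpa [Real.toNNReal_eq_zero] using hx
  have := nullSingletonClass_gaussianReal (μ := (stdGaussian E)[innerSL ℝ x]) hv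
  have h0 := measure_singleton (μ := gaussianReal ((stdGaussian E)[innerSL ℝ x])
    (‖x‖ ^ 2).toNNReal) (0 : ℝ)
  rw [← h, Measure.map_apply (by fun_prop) (measurableSet_singleton _)] at h0
  convert h0 using 2
  ext w
  simp [real_inner_comm]

/-- Resampling row `j` keeps the law; this puts its independence from the other rows in a form
suited to Fubini. -/
theorem map_update_gaussRows [DecidableEq ι] (j : ι) :
    ((gaussRows ι E).prod (stdGaussian E)).map (fun q => Function.update q.1 j q.2) =
      gaussRows ι E := by
  have hm : Measurable fun q : (ι → E) × E => Function.update q.1 j q.2 := measurable_update'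
  refine (Measure.pi_eq fun s hs => ?_).symm
  rw [Measure.map_apply hm (.univ_pi hs)]
  have : (fun q : (ι → E) × E => Function.update q.1 j q.2) ⁻¹' (Set.univ.pi s) =
      (Set.univ.pi (Function.update s j Set.univ)) ×ˢ s j := by
    ext ⟨v, w⟩
    simp only [Set.mem_preimage, Set.mem_pi, Set.mem_univ, true_imp_iff, Set.mem_prod]
    constructor
    · intro h
      refine ⟨fun i => ?_, by simpa using h j⟩
      by_cases hi : i = j
      · subst hi; simp
      · simpa [hi] using h i
    · rintro ⟨h1, h2⟩ i
      by_cases hi : i = j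
      · subst hi; simpa using h2
      · simpa [hi] using h1 i
  rw [this, Measure.prod_prod, Measure.pi_pi, ← Finset.mul_prod_erase _ _ (Finset.mem_univ j),
    ← Finset.mul_prod_erase _ (fun i => stdGaussian E (s i)) (Finset.mem_univ j)]
  simp only [Function.update_self, measure_univ, one_mul]
  rw [mul_comm]
  congr 1
  exact Finset.prod_congr rfl fun i hi => by
    rw [Function.update_of_ne (Finset.ne_of_mem_erase hi)]

/-- The residual does not involve row `j`. Conditionally on the other rows, a fresh Gaussian vector
lies in a fixed hyperplane with probability zero. -/
theorem gaussRows_inner_res_eq_zero (x : E) {T : Finset ι} {j : ι} (hj : j ∉ T) :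
    gaussRows ι E {v | res v T x ≠ 0 ∧ ⟪v j, res v T x⟫ = 0} = 0 := by
  classical
  have hres := measurable_res_left (ι := ι) T x
  have hset : MeasurableSet {v : ι → E | res v T x ≠ 0 ∧ ⟪v j, res v T x⟫ = 0} :=
    (measurableSet_eq_fun hres measurable_const).compl.inter
      (measurableSet_eq_fun ((measurable_pi_apply j).inner hres) measurable_const)
  have hm : Measurable fun q : (ι → E) × E => Function.update q.1 j q.2 := measurable_update'
  have hpre : (fun q : (ι → E) × E => Function.update q.1 j q.2) ⁻¹'
      {v : ι → E | res v T x ≠ 0 ∧ ⟪v j, res v T x⟫ = 0} =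
      {q | res q.1 T x ≠ 0 ∧ ⟪q.2, res q.1 T x⟫ = 0} := by
    ext q
    have hcongr : res (Function.update q.1 j q.2) T x = res q.1 T x := by
      refine res_congr (fun i hi => ?_) x
      have hij : i ≠ j := by rintro rfl; exact hj hi
      simp [hij]
    simp only [Set.mem_preimage, Set.mem_ofPred_eq, hcongr, Function.update_self]
  rw [← map_update_gaussRows j, Measure.map_apply hm hset,
    Measure.measure_prod_null (hm hset), hpre]
  refine Eventually.of_forall fun v => ?_
  by_cases h0 : res v T x = 0
  · simp [h0]
  · refine measure_mono_null (fun w hw => ?_) (stdGaussian_inner_eq_zero h0)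
    exact hw.2

theorem ae_isGeneric (x : E) : ∀ᵐ v ∂gaussRows ι E, IsGeneric v x := by
  unfold IsGeneric
  rw [ae_all_iff]
  intro T
  rw [ae_all_iff]
  intro j
  by_cases hj : j ∈ T
  · exact Eventually.of_forall fun v h => absurd hj h
  · refine measure_mono_null (fun v hv => ?_) (gaussRows_inner_res_eq_zero x hj)
    simpa [hj] using hv

theorem measurePreserving_isometries (e : ι → E ≃ₗᵢ[ℝ] E) :
    MeasurePreserving (fun (v : ι → E) i => e i (v i)) (gaussRows ι E) (gaussRows ι E) := by
  have hm : Measurable fun (v : ι → E) i => e i (v i) :=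
    measurable_pi_iff.2 fun i => (e i).continuous.measurable.comp (measurable_pi_apply i)
  refine ⟨hm, ?_⟩
  have h : ∀ i, (stdGaussian E).map (e i) = stdGaussian E := fun i => stdGaussian_map (e i)
  have : ∀ i, SigmaFinite ((stdGaussian E).map (e i)) := fun i => by rw [h]; infer_instance
  rw [Measure.pi_map_pi fun i => (e i).continuous.measurable.aemeasurable]
  simp only [h]

theorem sum_measureReal_le {Ω σ : Type*} [MeasurableSpace Ω] [Fintype σ] (μ : Measure Ω)
    [IsProbabilityMeasure μ] {D : σ → Set Ω} (hD : ∀ s, MeasurableSet (D s)) {K : ℝ}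
    (h : ∀ ω, ∑ s, (D s).indicator (1 : Ω → ℝ) ω ≤ K) : ∑ s, μ.real (D s) ≤ K := by
  have hint : ∀ s, Integrable ((D s).indicator (1 : Ω → ℝ)) μ := fun s =>
    (integrable_const (1 : ℝ)).indicator (hD s)
  calc ∑ s, μ.real (D s) = ∑ s, ∫ ω, (D s).indicator (1 : Ω → ℝ) ω ∂μ := by
        simp only [integral_indicator_one (hD _)]
    _ = ∫ ω, ∑ s, (D s).indicator (1 : Ω → ℝ) ω ∂μ :=
        (integral_finsetSum _ fun s _ => hint s).symm
    _ ≤ ∫ _, K ∂μ := integral_mono (integrable_finsetSum _ fun s _ => hint s)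
        (integrable_const K) h
    _ = K := by simp

/-- The squared norm of the residual of a fixed vector concentrates around the dimension of the
orthogonal complement. -/
theorem measureReal_norm_sq_res_dev_le {n : ℕ} (hn : Module.finrank ℝ E = n) (hn0 : 0 < n)
    (T : Finset ι) {x : E} (hx : ‖x‖ ^ 2 = n) {t : ℝ} (ht : 0 < t) :
    (gaussRows ι E).real
      {v | t * n ≤ |‖res v T x‖ ^ 2 - Module.finrank ℝ (annih v T)|} ≤ 2 / (t ^ 2 * n) := by
  classical
  have hnpos : (0 : ℝ) < n := by exact_mod_cast hn0
  set b : OrthonormalBasis (Fin n) ℝ E := (stdOrthonormalBasis ℝ E).reindex (finCongr hn)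
  set D : E → Set (ι → E) := fun y =>
    {v | t * n ≤ |‖res v T y‖ ^ 2 - Module.finrank ℝ (annih v T)|} with hD
  have hmeas : ∀ y, MeasurableSet (D y) := by
    intro y
    have h1 : Measurable fun v : ι → E =>
        |‖res v T y‖ ^ 2 - ∑ k, ‖res v T (b k)‖ ^ 2| := by
      have h2 : Measurable fun v : ι → E => ∑ k, ‖res v T (b k)‖ ^ 2 :=
        Finset.measurable_sum _ fun k _ => (measurable_res_left T (b k)).norm.pow_const 2
      exact (((measurable_res_left T y).norm.pow_const 2).sub h2).abs
    simp only [hD, ← sum_norm_sq_res b]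
    exact measurableSet_le measurable_const h1
  have hrot : ∀ y, ‖y‖ = ‖x‖ → (gaussRows ι E).real (D y) = (gaussRows ι E).real (D x) := by
    intro y hy
    -- This reflection exchanges two vectors of equal norm. Applied to all rows it preserves their
    -- law, so the probability depends on the vector only through its norm.
    set e : E ≃ₗᵢ[ℝ] E := (ℝ ∙ (x - y))ᗮ.reflection
    have hexy : e x = y := Submodule.reflection_sub hy.symm
    have hmp := measurePreserving_isometries (ι := ι) (fun _ => e)
    have := hmp.measureReal_preimage (hmeas y).nullMeasurableSet
    rw [← this]
    congr 1
    ext v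
    simp only [hD, Set.mem_preimage, Set.mem_ofPred_eq]
    rw [← hexy, res_isometry, e.norm_map, finrank_annih_isometry]
  -- All `2 ^ n` sign vectors have norm `√n`, so their deviation probabilities coincide. Their sum
  -- is bounded for each fixed `v` by Chebyshev over the signs.
  set y : Finset (Fin n) → E := fun s => ∑ k, sgn s k • b k with hy
  have hynorm : ∀ s, ‖y s‖ = ‖x‖ := by
    intro s
    have : ‖y s‖ ^ 2 = n := by
      rw [← b.sum_sq_norm_inner_right (y s)]
      have : ∀ k, ‖⟪b k, y s⟫‖ ^ 2 = 1 := fun k => by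
        rw [hy, Real.norm_eq_abs, sq_abs, b.orthonormal.inner_right_fintype, sq, sgn_mul_self]
      simp only [this]
      simp
    exact (sq_eq_sq₀ (norm_nonneg _) (norm_nonneg _)).1 (this.trans hx.symm)
  have hsum : ∑ s, (gaussRows ι E).real (D (y s)) ≤ 2 ^ n * (2 / (t ^ 2 * n)) := by
    refine sum_measureReal_le _ (fun s => hmeas _) fun v => ?_
    have hle := sum_sq_norm_sq_res_sub_le b v T
    rw [Fintype.card_fin] at hle
    have hpt : ∀ s, (D (y s)).indicator (1 : (ι → E) → ℝ) v ≤
        (‖res v T (y s)‖ ^ 2 - Module.finrank ℝ (annih v T)) ^ 2 / (t * n) ^ 2 := by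
      intro s
      by_cases hv : v ∈ D (y s)
      · rw [Set.indicator_of_mem hv, Pi.one_apply, one_le_div (by positivity), ← sq_abs (_ - _)]
        exact pow_le_pow_left₀ (by positivity) hv 2
      · rw [Set.indicator_of_notMem hv]; positivity
    refine (Finset.sum_le_sum fun s _ => hpt s).trans ?_
    rw [← Finset.sum_div, div_le_iff₀ (by positivity)]
    refine hle.trans (le_of_eq ?_)
    field_simp
  simp only [hrot _ (hynorm _)] at hsum
  simp only [Finset.sum_const, Finset.card_univ, Fintype.card_finset, Fintype.card_fin,
    nsmul_eq_mul, Nat.cast_pow, Nat.cast_ofNat] at hsum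
  exact le_of_mul_le_mul_left hsum (by positivity)

theorem ae_finrank_annih_le :
    ∀ᵐ v ∂gaussRows ι E, ∀ T : Finset ι,
      Module.finrank ℝ (annih v T) ≤ Module.finrank ℝ E - T.card := by
  have : ∀ᵐ v ∂gaussRows ι E, ∀ k, IsGeneric v (stdOrthonormalBasis ℝ E k) :=
    ae_all_iff.2 fun k => ae_isGeneric _
  filter_upwards [this] with v hv
  exact finrank_annih_le_of_isGeneric _ hv

end GaussianRows

/-! ### Sign flips of the inequality rows -/

section RowSigns

variable {κ ι E : Type*} [DecidableEq ι]

/-- The signs `sgn s` on the inequality rows, and no sign change on the equality rows. -/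
def rowSgn (κ : Type*) (s : Finset ι) : κ ⊕ ι → ℝ := Sum.elim (fun _ => 1) (sgn s)

theorem rowSgn_ne_zero (s : Finset ι) (i : κ ⊕ ι) : rowSgn κ s i ≠ 0 := by
  rcases i with k | i
  · simp [rowSgn]
  · exact sgn_ne_zero s i

variable [Fintype κ] [NormedAddCommGroup E] [InnerProductSpace ℝ E] [FiniteDimensional ℝ E]

theorem faceEvent_rowSgn_iff (v : κ ⊕ ι → E) (x : E) (S s : Finset ι) :
    FaceEvent (fun i => rowSgn κ s i • v i) x S ↔
      res v (faceRows κ S) x ≠ 0 ∧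
      (∀ j ∉ S, sgn s j * ⟪v (.inr j), res v (faceRows κ S) x⟫ < 0) ∧
      ∀ i ∈ S, 0 < sgn s i * ⟪v (.inr i), res v (faceRows κ (S.erase i)) x⟫ := by
  simp only [FaceEvent, res_smul_units (rowSgn_ne_zero (κ := κ) s), inner_smul_left,
    RCLike.conj_to_real]
  rfl

/-- The residuals ignore the signs, so each strict inequality of the face event fixes the sign of
its own row. -/
theorem faceEvent_rowSgn_unique {v : κ ⊕ ι → E} {x : E} {S s t : Finset ι}
    (hs : FaceEvent (fun i => rowSgn κ s i • v i) x S)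
    (ht : FaceEvent (fun i => rowSgn κ t i • v i) x S) : s = t := by
  rw [faceEvent_rowSgn_iff] at hs ht
  ext i
  have hpos : 0 < sgn s i * sgn t i := by
    by_cases hi : i ∈ S
    · have := mul_pos (hs.2.2 i hi) (ht.2.2 i hi)
      rw [mul_mul_mul_comm] at this
      exact pos_of_mul_pos_left this (mul_self_nonneg _)
    · have := mul_pos_of_neg_of_neg (hs.2.1 i hi) (ht.2.1 i hi)
      rw [mul_mul_mul_comm] at this
      exact pos_of_mul_pos_left this (mul_self_nonneg _)
  by_cases h1 : i ∈ s <;> by_cases h2 : i ∈ t <;> simp [sgn, h1, h2] at hpos ⊢ <;> linarith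

theorem exists_faceEvent_rowSgn [Fintype ι] {v : κ ⊕ ι → E} {x : E}
    (hgen : IsGeneric v x) {S : Finset ι} (h0 : res v (faceRows κ S) x ≠ 0) :
    ∃ s : Finset ι, FaceEvent (fun i => rowSgn κ s i • v i) x S := by
  classical
  refine ⟨Finset.univ.filter fun i =>
    (i ∉ S ∧ 0 < ⟪v (.inr i), res v (faceRows κ S) x⟫) ∨
    (i ∈ S ∧ ⟪v (.inr i), res v (faceRows κ (S.erase i)) x⟫ < 0), ?_⟩
  rw [faceEvent_rowSgn_iff]
  refine ⟨h0, fun j hj => ?_, fun i hi => ?_⟩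
  · have hne := hgen (faceRows κ S) (.inr j) (by simpa using hj) h0
    rcases lt_or_gt_of_ne hne with h | h
    · simp [sgn, hj, h, h.not_gt]
    · simp [sgn, hj, h]
  · have h1 : res v (faceRows κ (S.erase i)) x ≠ 0 := norm_pos_iff.1
      ((norm_pos_iff.2 h0).trans_le
        (norm_res_le_of_subset v (faceRows_mono (Finset.erase_subset i S)) x))
    have hne := hgen (faceRows κ (S.erase i)) (.inr i) (by simp) h1
    rcases lt_or_gt_of_ne hne with h | h
    · simp [sgn, hi, h]
    · simp [sgn, hi, h, h.not_gt]

end RowSigns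

/-! ### The projection as a uniform mixture of residuals -/

section FaceProbability

variable {κ ι E : Type*} [Fintype κ] [Fintype ι] [DecidableEq ι] [NormedAddCommGroup E]
  [InnerProductSpace ℝ E] [FiniteDimensional ℝ E] [MeasurableSpace E] [BorelSpace E]

theorem measurePreserving_rowSgn (s : Finset ι) :
    MeasurePreserving (fun (v : κ ⊕ ι → E) i => rowSgn κ s i • v i)
      (gaussRows (κ ⊕ ι) E) (gaussRows (κ ⊕ ι) E) := by
  classical
  convert! measurePreserving_isometries (ι := κ ⊕ ι) (E := E) (fun i =>
    if rowSgn κ s i = 1 then LinearIsometryEquiv.refl ℝ E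
    else LinearIsometryEquiv.neg ℝ) using 3 with v i
  rcases i with k | i
  · simp [rowSgn]
  · by_cases h : i ∈ s <;> norm_num [rowSgn, sgn, h]

theorem measurableSet_faceEvent (x : E) (S : Finset ι) :
    MeasurableSet {v : κ ⊕ ι → E | FaceEvent v x S} := by
  have hin : ∀ i T, Measurable fun v : κ ⊕ ι → E => ⟪v i, res v T x⟫ := fun i T =>
    (measurable_pi_apply i).inner (measurable_res_left T x)
  unfold FaceEvent
  refine MeasurableSet.inter ?_ (MeasurableSet.inter ?_ ?_)
  · exact (measurable_res_left _ x (measurableSet_singleton 0)).compl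
  · change MeasurableSet {v : κ ⊕ ι → E | ∀ j ∉ S, ⟪v (.inr j), res v (faceRows κ S) x⟫ < 0}
    simp only [Set.ofPred_forall]
    exact MeasurableSet.iInter fun j => MeasurableSet.iInter fun _ =>
      measurableSet_lt (hin _ _) measurable_const
  · change MeasurableSet
      {v : κ ⊕ ι → E | ∀ i ∈ S, 0 < ⟪v (.inr i), res v (faceRows κ (S.erase i)) x⟫}
    simp only [Set.ofPred_forall]
    exact MeasurableSet.iInter fun j => MeasurableSet.iInter fun _ =>
      measurableSet_lt measurable_const (hin _ _)

/-- The sign-flipped copies of the event are equiprobable and disjoint, and almost surely they cover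
`{res ∈ G}`. The covering needs a nonzero residual, hence `0 ∉ G`. -/
theorem two_pow_mul_measureReal_faceEvent (x : E) (S : Finset ι) {G : Set E}
    (hG : MeasurableSet G) (hG0 : (0 : E) ∉ G) :
    2 ^ Fintype.card ι * (gaussRows (κ ⊕ ι) E).real
        {v | FaceEvent v x S ∧ res v (faceRows κ S) x ∈ G} =
      (gaussRows (κ ⊕ ι) E).real {v | res v (faceRows κ S) x ∈ G} := by
  set H : Finset ι → Set (κ ⊕ ι → E) := fun s =>
    {v | FaceEvent (fun i => rowSgn κ s i • v i) x S ∧ res v (faceRows κ S) x ∈ G} with hH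
  have hmeas0 : MeasurableSet {v : κ ⊕ ι → E | FaceEvent v x S ∧ res v (faceRows κ S) x ∈ G} :=
    (measurableSet_faceEvent x S).inter (measurable_res_left _ x hG)
  have hHpre : ∀ s, H s = (fun (v : κ ⊕ ι → E) i => rowSgn κ s i • v i) ⁻¹'
      {v | FaceEvent v x S ∧ res v (faceRows κ S) x ∈ G} := by
    intro s
    ext v
    simp only [hH, Set.mem_ofPred_eq, Set.mem_preimage, res_smul_units (rowSgn_ne_zero (κ := κ) s)]
  have hHm : ∀ s, MeasurableSet (H s) := fun s => by
    rw [hHpre]; exact (measurePreserving_rowSgn s).measurable hmeas0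
  have hHeq : ∀ s, (gaussRows (κ ⊕ ι) E).real (H s) = (gaussRows (κ ⊕ ι) E).real
      {v | FaceEvent v x S ∧ res v (faceRows κ S) x ∈ G} := fun s => by
    rw [hHpre]; exact (measurePreserving_rowSgn s).measureReal_preimage hmeas0.nullMeasurableSet
  have hdisj : Pairwise (Function.onFun Disjoint H) := fun s t hst =>
    Set.disjoint_left.2 fun v hs ht => hst (faceEvent_rowSgn_unique hs.1 ht.1)
  have hunion : (⋃ s, H s) =ᵐ[gaussRows (κ ⊕ ι) E] {v | res v (faceRows κ S) x ∈ G} := by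
    filter_upwards [ae_isGeneric x] with v hv
    apply propext
    change v ∈ (⋃ s, H s) ↔ res v (faceRows κ S) x ∈ G
    rw [Set.mem_iUnion]
    constructor
    · rintro ⟨s, hs⟩; exact hs.2
    · intro h
      obtain ⟨s, hs⟩ := exists_faceEvent_rowSgn hv (S := S) fun h0 => hG0 (h0 ▸ h)
      exact ⟨s, hs, h⟩
  rw [← measureReal_congr hunion, measureReal_iUnion_fintype hdisj hHm]
  simp [hHeq]

theorem measurableSet_exists_faceEvent (x : E) {G : Set E} (hG : MeasurableSet G) :
    MeasurableSet {v : κ ⊕ ι → E | ∃ S, FaceEvent v x S ∧ res v (faceRows κ S) x ∈ G} := by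
  simp only [Set.ofPred_exists]
  exact MeasurableSet.iUnion fun S =>
    (measurableSet_faceEvent x S).inter (measurable_res_left _ x hG)

theorem ae_isConeProj_iff_exists_faceEvent (x : E) {G : Set E} (hG0 : (0 : E) ∉ G) :
    ∀ᵐ v ∂gaussRows (κ ⊕ ι) E, (∃ p, IsConeProj v x p ∧ p ∈ G) ↔
      ∃ S, FaceEvent v x S ∧ res v (faceRows κ S) x ∈ G := by
  filter_upwards [ae_isGeneric x] with v hv
  constructor
  · rintro ⟨p, hp, hpG⟩
    obtain ⟨S, hS, rfl⟩ := hp.exists_faceEvent (fun h0 => hG0 (h0 ▸ hpG)) hv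
    exact ⟨S, hS, hpG⟩
  · rintro ⟨S, hS, hG⟩
    exact ⟨_, hS.isConeProj, hG⟩

theorem nullMeasurableSet_isConeProj (x : E) {G : Set E} (hG : MeasurableSet G)
    (hG0 : (0 : E) ∉ G) :
    NullMeasurableSet {v : κ ⊕ ι → E | ∃ p, IsConeProj v x p ∧ p ∈ G}
      (gaussRows (κ ⊕ ι) E) := by
  refine (measurableSet_exists_faceEvent x hG).nullMeasurableSet.congr ?_
  filter_upwards [ae_isConeProj_iff_exists_faceEvent x hG0] with v hv
  exact propext hv.symm

/-- The law of the projection of `x` on the Gaussian cone is the mixture of the laws of the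
residuals over a uniformly random set of active inequalities. -/
theorem two_pow_mul_measureReal_isConeProj (x : E) {G : Set E} (hG : MeasurableSet G)
    (hG0 : (0 : E) ∉ G) :
    2 ^ Fintype.card ι * (gaussRows (κ ⊕ ι) E).real {v | ∃ p, IsConeProj v x p ∧ p ∈ G} =
      ∑ S : Finset ι, (gaussRows (κ ⊕ ι) E).real {v | res v (faceRows κ S) x ∈ G} := by
  have h1 : {v : κ ⊕ ι → E | ∃ p, IsConeProj v x p ∧ p ∈ G} =ᵐ[gaussRows (κ ⊕ ι) E]
      ⋃ S, {v | FaceEvent v x S ∧ res v (faceRows κ S) x ∈ G} := by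
    filter_upwards [ae_isConeProj_iff_exists_faceEvent x hG0] with v hv
    apply propext
    change (∃ p, IsConeProj v x p ∧ p ∈ G) ↔
      v ∈ ⋃ S, {v | FaceEvent v x S ∧ res v (faceRows κ S) x ∈ G}
    simpa using hv
  have hdisj : Pairwise (Function.onFun Disjoint fun S : Finset ι =>
      {v : κ ⊕ ι → E | FaceEvent v x S ∧ res v (faceRows κ S) x ∈ G}) := fun S T hST =>
    Set.disjoint_left.2 fun v hS hT => hST (hS.1.unique hT.1)
  rw [measureReal_congr h1, measureReal_iUnion_fintype hdisj fun S =>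
    (measurableSet_faceEvent x S).inter (measurable_res_left _ x hG), Finset.mul_sum]
  exact Finset.sum_congr rfl fun S _ => two_pow_mul_measureReal_faceEvent x S hG hG0

end FaceProbability

/-! ### The optimal value as a projection norm -/

section OptimalValue

variable {m₁ m₂ n : ℕ}

/-- The rows of `A` and `B` as a family of Euclidean vectors. -/
noncomputable def rows (A : Matrix (Fin m₁) (Fin n) ℝ) (B : Matrix (Fin m₂) (Fin n) ℝ) :
    Fin m₁ ⊕ Fin m₂ → EuclideanSpace ℝ (Fin n) :=
  Sum.elim (fun i => WithLp.toLp 2 (A i)) fun i => WithLp.toLp 2 (B i)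

theorem inner_toLp_row {m : ℕ} (A : Matrix (Fin m) (Fin n) ℝ) (i : Fin m)
    (x : EuclideanSpace ℝ (Fin n)) : ⟪WithLp.toLp 2 (A i), x⟫ = (A *ᵥ x.ofLp) i := by
  simp [PiLp.inner_apply, Matrix.mulVec, dotProduct, mul_comm]

theorem mem_feasible_iff (A : Matrix (Fin m₁) (Fin n) ℝ) (B : Matrix (Fin m₂) (Fin n) ℝ)
    (x : EuclideanSpace ℝ (Fin n)) :
    x ∈ feasible A B ↔ x ∈ polyCone (rows A B) ∧ ‖x‖ ≤ 1 := by
  change (A *ᵥ x.ofLp = 0 ∧ (∀ i, (B *ᵥ x.ofLp) i ≤ 0) ∧ ‖x‖ ≤ 1) ↔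
    ((∀ k, ⟪WithLp.toLp 2 (A k), x⟫ = 0) ∧ ∀ i, ⟪WithLp.toLp 2 (B i), x⟫ ≤ 0) ∧ ‖x‖ ≤ 1
  simp only [inner_toLp_row, funext_iff, Pi.zero_apply, and_assoc]

theorem fgl_eq_inner (c x : EuclideanSpace ℝ (Fin n)) : fgl c x = ⟪c, x⟫ := by
  simp [fgl, PiLp.inner_apply, mul_comm]

/-- The minimizer is `p / ‖p‖`, since `⟪c, p⟫ = -‖p‖²`. Optimality follows from `⟪c, x⟫ ≥ -⟪p, x⟫ ≥
-‖p‖` for feasible `x`. When `p = 0` the convention `0⁻¹ = 0` yields the minimizer `0`. -/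
theorem xiH_eq_neg_norm {A : Matrix (Fin m₁) (Fin n) ℝ} {B : Matrix (Fin m₂) (Fin n) ℝ}
    {c p : EuclideanSpace ℝ (Fin n)} (hp : IsConeProj (rows A B) (-c) p) :
    xiH (fgl c) A B = -‖p‖ := by
  have hcont : Continuous (fgl c) := by
    simp only [funext (fgl_eq_inner c)]; fun_prop
  refine (isLeast_xiH hcont A B).unique ⟨⟨‖p‖⁻¹ • p, ?_, ?_⟩, ?_⟩
  · rw [mem_feasible_iff, norm_smul, norm_inv, norm_norm]
    exact ⟨smul_mem_polyCone hp.mem (by positivity), inv_mul_le_one⟩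
  · have h := hp.inner_self
    rw [inner_sub_left, inner_neg_left, real_inner_self_eq_norm_sq] at h
    rw [fgl_eq_inner, inner_smul_right]
    have : ⟪c, p⟫ = -‖p‖ ^ 2 := by linarith
    rw [this]
    by_cases h0 : ‖p‖ = 0
    · simp [h0]
    · field_simp
  · rintro _ ⟨x, hx, rfl⟩
    rw [mem_feasible_iff] at hx
    have h := hp.inner_le x hx.1
    rw [inner_sub_left, inner_neg_left] at h
    rw [fgl_eq_inner]
    have h1 := real_inner_le_norm p x
    have h2 := mul_le_mul_of_nonneg_left hx.2 (norm_nonneg p)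
    linarith

theorem xiH_nonpos (c : EuclideanSpace ℝ (Fin n)) (A : Matrix (Fin m₁) (Fin n) ℝ)
    (B : Matrix (Fin m₂) (Fin n) ℝ) : xiH (fgl c) A B ≤ 0 := by
  obtain ⟨p, hp⟩ := exists_isConeProj (rows A B) (-c)
  rw [xiH_eq_neg_norm hp]
  simp

theorem xiH_zero (A : Matrix (Fin m₁) (Fin n) ℝ) (B : Matrix (Fin m₂) (Fin n) ℝ) :
    xiH (fgl 0) A B = 0 := by
  have hp : IsConeProj (rows A B) (-0) 0 := ⟨zero_mem_polyCone _, by simp, by simp⟩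
  rw [xiH_eq_neg_norm hp]
  simp

end OptimalValue

/-! ### From i.i.d. entries to independent Gaussian rows -/

section Law

theorem map_sumElim_pi_pi {κ₁ κ₂ ι X : Type*} [Fintype κ₁] [Fintype κ₂] [Fintype ι]
    [MeasurableSpace X] (μ : Measure X) [IsProbabilityMeasure μ] :
    (Measure.pi fun _ : κ₁ ⊕ κ₂ => Measure.pi fun _ : ι => μ).map
      (fun v => Sum.elim (fun p : κ₁ × ι => v (.inl p.1) p.2)
        fun p : κ₂ × ι => v (.inr p.1) p.2) =
      Measure.pi fun _ : (κ₁ × ι) ⊕ (κ₂ × ι) => μ := by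
  have hm : Measurable fun v : κ₁ ⊕ κ₂ → ι → X =>
      Sum.elim (fun p : κ₁ × ι => v (.inl p.1) p.2) fun p : κ₂ × ι => v (.inr p.1) p.2 := by
    rw [measurable_pi_iff]
    rintro (p | p) <;> simp only [Sum.elim_inl, Sum.elim_inr] <;> fun_prop
  refine (Measure.pi_eq fun s hs => ?_).symm
  rw [Measure.map_apply hm (.univ_pi hs)]
  have : (fun v : κ₁ ⊕ κ₂ → ι → X => Sum.elim (fun p : κ₁ × ι => v (.inl p.1) p.2)
      fun p : κ₂ × ι => v (.inr p.1) p.2) ⁻¹' Set.univ.pi s =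
      Set.univ.pi fun k => Set.univ.pi fun i =>
        Sum.elim (fun k => s (.inl (k, i))) (fun k => s (.inr (k, i))) k := by
    ext v
    simp [Set.mem_pi, Sum.forall]
  rw [this, Measure.pi_pi]
  simp only [Measure.pi_pi, Fintype.prod_sum_type, Sum.elim_inl, Sum.elim_inr,
    Fintype.prod_prod_type]

variable {Ω : Type*} [MeasurableSpace Ω] {P : Measure Ω} {m₁ m₂ n : ℕ}
  {A : Ω → Matrix (Fin m₁) (Fin n) ℝ} {B : Ω → Matrix (Fin m₂) (Fin n) ℝ}

theorem IsStdGaussianPair.hasLaw_rows (h : IsStdGaussianPair P A B) :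
    HasLaw (fun ω => rows (A ω) (B ω))
      (gaussRows (Fin m₁ ⊕ Fin m₂) (EuclideanSpace ℝ (Fin n))) P := by
  set J := (Fin m₁ × Fin n) ⊕ (Fin m₂ × Fin n)
  have h1 : HasLaw (fun ω (k : J) => Sum.elim (fun p : Fin m₁ × Fin n => A ω p.1 p.2)
      (fun p : Fin m₂ × Fin n => B ω p.1 p.2) k)
      (Measure.pi fun _ : J => gaussianReal 0 1) P := by
    refine h.indep.hasLaw_pi fun k => ?_
    rcases k with p | p
    · exact h.lawA p.1 p.2
    · exact h.lawB p.1 p.2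
  set Φ : (J → ℝ) → Fin m₁ ⊕ Fin m₂ → EuclideanSpace ℝ (Fin n) := fun w k =>
    WithLp.toLp 2 fun j => Sum.elim (fun i => w (.inl (i, j))) (fun i => w (.inr (i, j))) k with hΦ
  have hΦm : Measurable Φ := by
    rw [measurable_pi_iff]
    intro k
    refine (WithLp.measurable_toLp 2 _).comp (measurable_pi_iff.2 fun j => ?_)
    rcases k with i | i <;> exact measurable_pi_apply _
  have h2 : (Measure.pi fun _ : J => gaussianReal 0 1).map Φ =
      gaussRows (Fin m₁ ⊕ Fin m₂) (EuclideanSpace ℝ (Fin n)) := by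
    rw [← map_sumElim_pi_pi, Measure.map_map hΦm]
    · have hcomp : Φ ∘ (fun v : Fin m₁ ⊕ Fin m₂ → Fin n → ℝ =>
          Sum.elim (fun p : Fin m₁ × Fin n => v (.inl p.1) p.2)
            fun p : Fin m₂ × Fin n => v (.inr p.1) p.2) =
          fun v k => WithLp.toLp 2 (v k) := by
        funext v k
        rcases k with i | i <;> rfl
      have hlp : (Measure.pi fun _ : Fin n => gaussianReal 0 1).map (WithLp.toLp 2) =
          stdGaussian (EuclideanSpace ℝ (Fin n)) := map_pi_eq_stdGaussian
      have : ∀ _ : Fin m₁ ⊕ Fin m₂, SigmaFinite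
          ((Measure.pi fun _ : Fin n => gaussianReal 0 1).map (WithLp.toLp 2)) := fun _ => by
        rw [hlp]; infer_instance
      rw [hcomp, Measure.pi_map_pi fun _ => (WithLp.measurable_toLp 2 _).aemeasurable]
      simp only [hlp]
    · rw [measurable_pi_iff]
      rintro (p | p) <;> simp only [Sum.elim_inl, Sum.elim_inr] <;> fun_prop
  have h3 : HasLaw Φ (gaussRows (Fin m₁ ⊕ Fin m₂) (EuclideanSpace ℝ (Fin n)))
      (Measure.pi fun _ : J => gaussianReal 0 1) := ⟨hΦm.aemeasurable, h2⟩
  convert! h3.comp h1 using 1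
  funext ω k
  rcases k with i | i <;> rfl

theorem IsStdGaussianPair.measureReal_isConeProj (h : IsStdGaussianPair P A B)
    (x : EuclideanSpace ℝ (Fin n)) {G : Set (EuclideanSpace ℝ (Fin n))} (hG : MeasurableSet G)
    (hG0 : (0 : EuclideanSpace ℝ (Fin n)) ∉ G) :
    P.real {ω | ∃ p, IsConeProj (rows (A ω) (B ω)) x p ∧ p ∈ G} =
      (gaussRows (Fin m₁ ⊕ Fin m₂) (EuclideanSpace ℝ (Fin n))).real
        {v | ∃ p, IsConeProj v x p ∧ p ∈ G} := by
  have hX := h.hasLaw_rows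
  have hnull := nullMeasurableSet_isConeProj (κ := Fin m₁) (ι := Fin m₂) x hG hG0
  rw [← hX.map_eq] at hnull
  rw [measureReal_def, measureReal_def, ← hX.map_eq, Measure.map_apply₀ hX.aemeasurable hnull]
  rfl

theorem IsStdGaussianPair.measureReal_not_isConeProj_le (h : IsStdGaussianPair P A B)
    (x : EuclideanSpace ℝ (Fin n)) {G : Set (EuclideanSpace ℝ (Fin n))} (hG : MeasurableSet G)
    (hG0 : (0 : EuclideanSpace ℝ (Fin n)) ∉ G) :
    P.real {ω | ¬∃ p, IsConeProj (rows (A ω) (B ω)) x p ∧ p ∈ G} ≤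
      1 - (gaussRows (Fin m₁ ⊕ Fin m₂) (EuclideanSpace ℝ (Fin n))).real
        {v | ∃ p, IsConeProj v x p ∧ p ∈ G} := by
  have hX := h.hasLaw_rows
  have hnull := nullMeasurableSet_isConeProj (κ := Fin m₁) (ι := Fin m₂) x hG hG0
  rw [← probReal_compl_eq_one_sub₀ hnull, measureReal_def, measureReal_def]
  refine ENNReal.toReal_mono (measure_ne_top _ _) ?_
  have := Measure.le_map_apply hX.aemeasurable {v | ∃ p, IsConeProj v x p ∧ p ∈ G}ᶜ
  rw [hX.map_eq] at this
  exact this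

end Law

/-! ### Finite-dimensional tail bounds for the optimal value -/

section Tails

variable {m₁ m₂ n : ℕ}

local notation "𝔼" n => EuclideanSpace ℝ (Fin n)

theorem card_faceRows (S : Finset (Fin m₂)) : (faceRows (Fin m₁) S).card = m₁ + S.card := by
  simp [faceRows]

theorem card_filter_finset_le {a : ℝ} (ha : 0 < a) {Q : Finset (Fin m₂) → Prop} [DecidablePred Q]
    (hQ : ∀ S, Q S → a ≤ |(S.card : ℝ) - m₂ / 2|) :
    ((Finset.univ.filter Q).card : ℝ) ≤ 2 ^ m₂ * (m₂ / (4 * a ^ 2)) := by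
  have h := card_filter_card_sub_half_le (ι := Fin m₂) ha
  rw [Fintype.card_fin] at h
  refine le_trans ?_ h
  exact_mod_cast Finset.card_le_card fun S hS => by
    simp only [Finset.mem_filter, Finset.mem_univ, true_and] at hS ⊢
    exact hQ S hS

/-- A uniform average over subsets is bounded through an exceptional family of subsets. -/
theorem le_of_two_pow_mul_eq_sum {q η δ : ℝ} {f : Finset (Fin m₂) → ℝ}
    (hq : 2 ^ m₂ * q = ∑ S, f S) {Q : Finset (Fin m₂) → Prop} [DecidablePred Q]
    (hη : 0 ≤ η) (hf1 : ∀ S, f S ≤ 1) (hf : ∀ S, ¬Q S → f S ≤ η)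
    (hQ : ((Finset.univ.filter Q).card : ℝ) ≤ 2 ^ m₂ * δ) : q ≤ δ + η := by
  have h1 : ∀ S, f S ≤ (if Q S then 1 else 0) + η := fun S => by
    split_ifs with h
    · linarith [hf1 S]
    · linarith [hf S h]
  have h2 : ∑ S, f S ≤ 2 ^ m₂ * δ + 2 ^ m₂ * η := by
    refine (Finset.sum_le_sum fun S _ => h1 S).trans ?_
    rw [Finset.sum_add_distrib, Finset.sum_boole]
    simp only [Finset.sum_const, Finset.card_univ, Fintype.card_finset, Fintype.card_fin,
      nsmul_eq_mul, Nat.cast_pow, Nat.cast_ofNat]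
    linarith
  rw [← hq, ← mul_add] at h2
  exact le_of_mul_le_mul_left h2 (by positivity)

theorem norm_sq_res_rescale {ι : Type*} {x : 𝔼 n} (hx : x ≠ 0)
    (v : ι → 𝔼 n) (T : Finset ι) :
    ‖res v T ((√n / ‖x‖) • x)‖ ^ 2 * ‖x‖ ^ 2 = n * ‖res v T x‖ ^ 2 := by
  have hx' : ‖x‖ ≠ 0 := norm_ne_zero_iff.2 hx
  rw [res_smul, norm_smul, Real.norm_eq_abs, mul_pow, sq_abs, div_pow,
    Real.sq_sqrt (Nat.cast_nonneg n)]
  field_simp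

theorem norm_sq_rescale {x : 𝔼 n} (hx : x ≠ 0) : ‖(√n / ‖x‖) • x‖ ^ 2 = (n : ℝ) := by
  have hx' : ‖x‖ ≠ 0 := norm_ne_zero_iff.2 hx
  rw [norm_smul, Real.norm_eq_abs, mul_pow, sq_abs, div_pow, Real.sq_sqrt (Nat.cast_nonneg n)]
  field_simp

/-- Almost surely the complement has dimension at most `(1 - β) n`, so after rescaling to norm `√n`
the event requires a deviation of at least `(β - γ) n`. When `T` has more than `n` rows the
dimension is zero, and `β ≤ 1` is what keeps the bound valid. -/
theorem measureReal_res_ge_le (hn : 0 < n) {ι : Type*} [Fintype ι] {x : 𝔼 n} (hx : x ≠ 0)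
    {γ β : ℝ} (hγβ : γ < β) (hβ : β ≤ 1) (T : Finset ι) (hT : β * n ≤ T.card) :
    (gaussRows ι (𝔼 n)).real {v | (1 - γ) * ‖x‖ ^ 2 ≤ ‖res v T x‖ ^ 2} ≤
      2 / ((β - γ) ^ 2 * n) := by
  have hn' : (0 : ℝ) < n := by exact_mod_cast hn
  refine le_trans ?_ (measureReal_norm_sq_res_dev_le (ι := ι) (E := 𝔼 n) (by simp) hn T
    (norm_sq_rescale hx) (sub_pos.2 hγβ))
  refine ENNReal.toReal_mono (measure_ne_top _ _) (measure_mono_ae ?_)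
  filter_upwards [ae_finrank_annih_le (ι := ι) (E := 𝔼 n)] with v hv hmem
  replace hmem : (1 - γ) * ‖x‖ ^ 2 ≤ ‖res v T x‖ ^ 2 := hmem
  change (β - γ) * n ≤ |_|
  have hpos : 0 < ‖x‖ ^ 2 := by have := norm_pos_iff.2 hx; positivity
  have h1 : (1 - γ) * n ≤ ‖res v T ((√n / ‖x‖) • x)‖ ^ 2 := by
    have h := norm_sq_res_rescale hx v T
    refine le_of_mul_le_mul_right (a := ‖x‖ ^ 2) ?_ hpos
    rw [h]
    nlinarith
  have h2 : (Module.finrank ℝ (annih v T) : ℝ) ≤ (1 - β) * n := by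
    have h := hv T
    rw [finrank_euclideanSpace_fin] at h
    rcases le_total T.card n with hle | hle
    · have : (Module.finrank ℝ (annih v T) : ℝ) ≤ (n : ℝ) - T.card := by
        rw [← Nat.cast_sub hle]; exact_mod_cast h
      linarith
    · have h0 : Module.finrank ℝ (annih v T) = 0 := by omega
      rw [h0, Nat.cast_zero]
      exact mul_nonneg (by linarith) hn'.le
  exact le_trans (by linarith) (le_abs_self _)

theorem measureReal_res_ne_zero {ι : Type*} [Fintype ι] (x : 𝔼 n)
    (T : Finset ι) (hT : n ≤ T.card) :
    (gaussRows ι (𝔼 n)).real {v | res v T x ≠ 0} = 0 := by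
  rw [measureReal_eq_zero_iff]
  rw [← compl_mem_ae_iff]
  filter_upwards [ae_finrank_annih_le (ι := ι) (E := 𝔼 n)] with v hv
  have h := hv T
  rw [finrank_euclideanSpace_fin] at h
  have h0 : annih v T = ⊥ := Submodule.finrank_eq_zero.1 (by omega)
  have := res_mem v T x
  rw [h0, Submodule.mem_bot] at this
  simpa using this

theorem one_sub_le_measureReal_res_gt (hn : 0 < n) {ι : Type*} [Fintype ι] {x : 𝔼 n}
    (hx : x ≠ 0) {γ β : ℝ} (hβγ : β < γ) (T : Finset ι) (hT : T.card ≤ β * n) :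
    1 - 2 / ((γ - β) ^ 2 * n) ≤
      (gaussRows ι (𝔼 n)).real {v | (1 - γ) * ‖x‖ ^ 2 < ‖res v T x‖ ^ 2} := by
  have hn' : (0 : ℝ) < n := by exact_mod_cast hn
  have hm : MeasurableSet {v : ι → 𝔼 n | (1 - γ) * ‖x‖ ^ 2 < ‖res v T x‖ ^ 2} :=
    measurableSet_lt measurable_const ((measurable_res_left T x).norm.pow_const 2)
  have hc := probReal_compl_eq_one_sub (μ := gaussRows ι (𝔼 n)) hm
  have hle : (gaussRows ι (𝔼 n)).real {v | (1 - γ) * ‖x‖ ^ 2 < ‖res v T x‖ ^ 2}ᶜ ≤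
      2 / ((γ - β) ^ 2 * n) := by
    refine le_trans (measureReal_mono fun v hv => ?_) (measureReal_norm_sq_res_dev_le (ι := ι)
      (E := 𝔼 n) (by simp) hn T (norm_sq_rescale hx) (sub_pos.2 hβγ))
    replace hv : ‖res v T x‖ ^ 2 ≤ (1 - γ) * ‖x‖ ^ 2 := not_lt.1 hv
    change (γ - β) * n ≤ |_|
    have hpos : 0 < ‖x‖ ^ 2 := by have := norm_pos_iff.2 hx; positivity
    have h1 : ‖res v T ((√n / ‖x‖) • x)‖ ^ 2 ≤ (1 - γ) * n := by
      have h := norm_sq_res_rescale hx v T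
      refine le_of_mul_le_mul_right (a := ‖x‖ ^ 2) ?_ hpos
      rw [h]
      nlinarith
    have h2 : (1 - β) * n ≤ (Module.finrank ℝ (annih v T) : ℝ) := by
      have h := finrank_annih_ge v T
      rw [finrank_euclideanSpace_fin] at h
      have h' : (n : ℝ) ≤ Module.finrank ℝ (annih v T) + T.card := by exact_mod_cast h
      linarith
    rw [abs_sub_comm]
    exact le_trans (by linarith) (le_abs_self _)
  linarith

variable {Ω : Type*} [MeasurableSpace Ω] {P : Measure Ω} [IsProbabilityMeasure P]
  {A : Ω → Matrix (Fin m₁) (Fin n) ℝ} {B : Ω → Matrix (Fin m₂) (Fin n) ℝ}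

/-- The first term counts the subsets `S` with `m₁ + |S| < β n`. The second bounds the residual for
every other `S`. -/
theorem measureReal_xiH_le (h : IsStdGaussianPair P A B) (hn : 0 < n) {c : 𝔼 n} (hc : c ≠ 0)
    {γ β : ℝ} (hγβ : γ < β) (hβ : β ≤ 1) (hβm : β * n < m₁ + (m₂ : ℝ) / 2) :
    P.real {ω | xiH (fgl c) (A ω) (B ω) ≤ -√(1 - γ) * ‖c‖} ≤
      m₂ / (4 * (m₁ + (m₂ : ℝ) / 2 - β * n) ^ 2) + 2 / ((β - γ) ^ 2 * n) := by
  classical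
  set G : Set (𝔼 n) := {y | (1 - γ) * ‖-c‖ ^ 2 ≤ ‖y‖ ^ 2} with hG
  have hγ1 : 0 < 1 - γ := by linarith
  have hGm : MeasurableSet G := measurableSet_le measurable_const (measurable_norm.pow_const 2)
  have hG0 : (0 : 𝔼 n) ∉ G := by
    have := norm_pos_iff.2 hc
    have : 0 < (1 - γ) * ‖-c‖ ^ 2 := by rw [norm_neg]; positivity
    simpa [hG] using this
  have hsub : P.real {ω | xiH (fgl c) (A ω) (B ω) ≤ -√(1 - γ) * ‖c‖} ≤
      P.real {ω | ∃ p, IsConeProj (rows (A ω) (B ω)) (-c) p ∧ p ∈ G} := by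
    refine measureReal_mono fun ω hω => ?_
    obtain ⟨p, hp⟩ := exists_isConeProj (rows (A ω) (B ω)) (-c)
    refine ⟨p, hp, ?_⟩
    replace hω : xiH (fgl c) (A ω) (B ω) ≤ -√(1 - γ) * ‖c‖ := hω
    rw [xiH_eq_neg_norm hp] at hω
    have h1 : √(1 - γ) * ‖c‖ ≤ ‖p‖ := by linarith
    have h2 := pow_le_pow_left₀ (by positivity) h1 2
    rw [mul_pow, Real.sq_sqrt hγ1.le] at h2
    change (1 - γ) * ‖-c‖ ^ 2 ≤ ‖p‖ ^ 2
    rwa [norm_neg]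
  refine hsub.trans ?_
  rw [h.measureReal_isConeProj _ hGm hG0]
  have key := two_pow_mul_measureReal_isConeProj (κ := Fin m₁) (ι := Fin m₂) (-c) hGm hG0
  rw [Fintype.card_fin] at key
  refine le_of_two_pow_mul_eq_sum key (Q := fun S => ((m₁ + S.card : ℕ) : ℝ) < β * n)
    (by positivity) (fun S => measureReal_le_one) (fun S hS => ?_)
    (card_filter_finset_le (sub_pos.2 hβm) fun S hS => ?_)
  · refine measureReal_res_ge_le hn (neg_ne_zero.2 hc) hγβ hβ _ ?_
    rw [card_faceRows]; exact not_lt.1 hS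
  · rw [abs_sub_comm]
    push_cast at hS
    exact le_trans (by linarith) (le_abs_self _)

/-- As soon as `m₁ + |S| ≥ n` the residual vanishes almost surely, so only the count of small `S`
remains. -/
theorem measureReal_xiH_neg (h : IsStdGaussianPair P A B) (c : 𝔼 n)
    (hm : (n : ℝ) < m₁ + (m₂ : ℝ) / 2) :
    P.real {ω | xiH (fgl c) (A ω) (B ω) < 0} ≤
      m₂ / (4 * (m₁ + (m₂ : ℝ) / 2 - n) ^ 2) := by
  classical
  set G : Set (𝔼 n) := {y | y ≠ 0} with hG
  have hGm : MeasurableSet G := (measurableSet_singleton 0).compl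
  have hG0 : (0 : 𝔼 n) ∉ G := by simp [hG]
  have hsub : P.real {ω | xiH (fgl c) (A ω) (B ω) < 0} ≤
      P.real {ω | ∃ p, IsConeProj (rows (A ω) (B ω)) (-c) p ∧ p ∈ G} := by
    refine measureReal_mono fun ω hω => ?_
    obtain ⟨p, hp⟩ := exists_isConeProj (rows (A ω) (B ω)) (-c)
    refine ⟨p, hp, ?_⟩
    replace hω : xiH (fgl c) (A ω) (B ω) < 0 := hω
    rw [xiH_eq_neg_norm hp] at hω
    exact norm_pos_iff.1 (by linarith)
  refine hsub.trans ?_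
  rw [h.measureReal_isConeProj _ hGm hG0]
  have key := two_pow_mul_measureReal_isConeProj (κ := Fin m₁) (ι := Fin m₂) (-c) hGm hG0
  rw [Fintype.card_fin] at key
  refine (le_of_two_pow_mul_eq_sum key (Q := fun S => m₁ + S.card < n)
    le_rfl (fun S => measureReal_le_one) (fun S hS => ?_)
    (card_filter_finset_le (sub_pos.2 hm) fun S hS => ?_)).trans (add_zero _).le
  · refine (measureReal_res_ne_zero (-c) _ ?_).le
    rw [card_faceRows]; exact not_lt.1 hS
  · rw [abs_sub_comm]
    have hS' : ((m₁ + S.card : ℕ) : ℝ) < n := by exact_mod_cast hS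
    push_cast at hS'
    exact le_trans (by linarith) (le_abs_self _)

theorem measureReal_le_xiH (h : IsStdGaussianPair P A B) (hn : 0 < n) {c : 𝔼 n} (hc : c ≠ 0)
    {γ β : ℝ} (hβγ : β < γ) (hγ : γ ≤ 1) (hβm : m₁ + (m₂ : ℝ) / 2 < β * n) :
    P.real {ω | -√(1 - γ) * ‖c‖ ≤ xiH (fgl c) (A ω) (B ω)} ≤
      m₂ / (4 * (β * n - (m₁ + (m₂ : ℝ) / 2)) ^ 2) + 2 / ((γ - β) ^ 2 * n) := by
  classical
  set G : Set (𝔼 n) := {y | (1 - γ) * ‖-c‖ ^ 2 < ‖y‖ ^ 2} with hG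
  have hγ1 : 0 ≤ 1 - γ := by linarith
  have hGm : MeasurableSet G := measurableSet_lt measurable_const (measurable_norm.pow_const 2)
  have hG0 : (0 : 𝔼 n) ∉ G := by
    have : 0 ≤ (1 - γ) * ‖-c‖ ^ 2 := by positivity
    simpa [hG] using this
  have hsub : P.real {ω | -√(1 - γ) * ‖c‖ ≤ xiH (fgl c) (A ω) (B ω)} ≤
      P.real {ω | ¬∃ p, IsConeProj (rows (A ω) (B ω)) (-c) p ∧ p ∈ G} := by
    refine measureReal_mono fun ω hω => ?_
    rintro ⟨p, hp, hpG⟩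
    replace hω : -√(1 - γ) * ‖c‖ ≤ xiH (fgl c) (A ω) (B ω) := hω
    rw [xiH_eq_neg_norm hp] at hω
    have h1 : ‖p‖ ≤ √(1 - γ) * ‖c‖ := by linarith
    have h2 := pow_le_pow_left₀ (by positivity) h1 2
    rw [mul_pow, Real.sq_sqrt hγ1] at h2
    replace hpG : (1 - γ) * ‖-c‖ ^ 2 < ‖p‖ ^ 2 := hpG
    rw [norm_neg] at hpG
    linarith
  refine hsub.trans ((h.measureReal_not_isConeProj_le _ hGm hG0).trans ?_)
  have key := two_pow_mul_measureReal_isConeProj (κ := Fin m₁) (ι := Fin m₂) (-c) hGm hG0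
  rw [Fintype.card_fin] at key
  have key' : 2 ^ m₂ * (1 - (gaussRows (Fin m₁ ⊕ Fin m₂) (𝔼 n)).real
        {v | ∃ p, IsConeProj v (-c) p ∧ p ∈ G}) =
      ∑ S : Finset (Fin m₂), (1 - (gaussRows (Fin m₁ ⊕ Fin m₂) (𝔼 n)).real
        {v | res v (faceRows (Fin m₁) S) (-c) ∈ G}) := by
    rw [mul_sub, key, Finset.sum_sub_distrib]
    simp
  refine le_of_two_pow_mul_eq_sum key' (Q := fun S => β * n < ((m₁ + S.card : ℕ) : ℝ))
    (by positivity) (fun S => sub_le_self _ measureReal_nonneg) (fun S hS => ?_)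
    (card_filter_finset_le (sub_pos.2 hβm) fun S hS => ?_)
  · have := one_sub_le_measureReal_res_gt hn (neg_ne_zero.2 hc) hβγ (faceRows (Fin m₁) S) (by
      rw [card_faceRows]; exact not_lt.1 hS)
    have e : (gaussRows (Fin m₁ ⊕ Fin m₂) (𝔼 n)).real
        {v | res v (faceRows (Fin m₁) S) (-c) ∈ G} = (gaussRows (Fin m₁ ⊕ Fin m₂) (𝔼 n)).real
        {v | (1 - γ) * ‖-c‖ ^ 2 < ‖res v (faceRows (Fin m₁) S) (-c)‖ ^ 2} := rfl
    rw [e]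
    linarith
  · push_cast at hS
    exact le_trans (by linarith) (le_abs_self _)

end Tails

/-! ### Passage to the limit -/

section Limits

/-- The numerator has order at most `n` and the denominator has order `n²`, because `β` differs from
the limiting ratio. -/
theorem tendsto_binomial_tail_bound {m₁ m₂ : ℕ → ℕ} {α₁ α₂ β : ℝ}
    (hm₁ : Tendsto (fun n : ℕ => (m₁ n : ℝ) / n) atTop (𝓝 α₁))
    (hm₂ : Tendsto (fun n : ℕ => (m₂ n : ℝ) / n) atTop (𝓝 α₂)) (hβ : β ≠ α₁ + α₂ / 2) :
    Tendsto (fun n : ℕ => (m₂ n : ℝ) / (4 * (m₁ n + (m₂ n : ℝ) / 2 - β * n) ^ 2))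
      atTop (𝓝 0) := by
  have h1 : Tendsto (fun n : ℕ => (m₂ n : ℝ) / n /
      (4 * ((m₁ n : ℝ) / n + (m₂ n : ℝ) / n / 2 - β) ^ 2)) atTop
      (𝓝 (α₂ / (4 * (α₁ + α₂ / 2 - β) ^ 2))) := by
    refine hm₂.div ((((hm₁.add (hm₂.div_const 2)).sub_const β).pow 2).const_mul 4) ?_
    have : α₁ + α₂ / 2 - β ≠ 0 := sub_ne_zero.2 hβ.symm
    positivity
  have h2 := h1.mul (tendsto_inv_atTop_nhds_zero_nat (𝕜 := ℝ))
  rw [mul_zero] at h2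
  refine h2.congr' ?_
  filter_upwards [eventually_gt_atTop 0] with n hn
  have hn' : (n : ℝ) ≠ 0 := by exact_mod_cast hn.ne'
  have e : (m₁ n : ℝ) + (m₂ n : ℝ) / 2 - β * n =
      n * ((m₁ n : ℝ) / n + (m₂ n : ℝ) / n / 2 - β) := by
    field_simp
  rw [e, mul_pow]
  by_cases h0 : ((m₁ n : ℝ) / n + (m₂ n : ℝ) / n / 2 - β) = 0
  · simp [h0]
  · field_simp

theorem tendsto_chebyshev_bound (t : ℝ) :
    Tendsto (fun n : ℕ => 2 / (t ^ 2 * (n : ℝ))) atTop (𝓝 0) := by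
  have h := (tendsto_inv_atTop_nhds_zero_nat (𝕜 := ℝ)).const_mul (2 / t ^ 2)
  rw [mul_zero] at h
  refine h.congr fun n => ?_
  rw [← div_eq_mul_inv, div_div]

variable {m₁ m₂ : ℕ → ℕ} {α₁ α₂ : ℝ}

theorem eventually_mul_lt (hm₁ : Tendsto (fun n : ℕ => (m₁ n : ℝ) / n) atTop (𝓝 α₁))
    (hm₂ : Tendsto (fun n : ℕ => (m₂ n : ℝ) / n) atTop (𝓝 α₂)) {β : ℝ}
    (hβ : β < α₁ + α₂ / 2) : ∀ᶠ n : ℕ in atTop, β * n < m₁ n + (m₂ n : ℝ) / 2 := by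
  filter_upwards [(hm₁.add (hm₂.div_const 2)).eventually_const_lt hβ, eventually_gt_atTop 0]
    with n h hn
  have hn' : (0 : ℝ) < n := by exact_mod_cast hn
  rw [div_right_comm, ← add_div, lt_div_iff₀ hn'] at h
  exact h

theorem eventually_lt_mul (hm₁ : Tendsto (fun n : ℕ => (m₁ n : ℝ) / n) atTop (𝓝 α₁))
    (hm₂ : Tendsto (fun n : ℕ => (m₂ n : ℝ) / n) atTop (𝓝 α₂)) {β : ℝ}
    (hβ : α₁ + α₂ / 2 < β) : ∀ᶠ n : ℕ in atTop, m₁ n + (m₂ n : ℝ) / 2 < β * n := by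
  filter_upwards [(hm₁.add (hm₂.div_const 2)).eventually_lt_const hβ, eventually_gt_atTop 0]
    with n h hn
  have hn' : (0 : ℝ) < n := by exact_mod_cast hn
  rw [div_right_comm, ← add_div, div_lt_iff₀ hn'] at h
  exact h

variable {c : ∀ n : ℕ, EuclideanSpace ℝ (Fin n)} {Ω : ℕ → Type*} [∀ n, MeasurableSpace (Ω n)]
  {P : ∀ n, Measure (Ω n)} [∀ n, IsProbabilityMeasure (P n)]
  {A : ∀ n, Ω n → Matrix (Fin (m₁ n)) (Fin n) ℝ} {B : ∀ n, Ω n → Matrix (Fin (m₂ n)) (Fin n) ℝ}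

theorem tendsto_measureReal_xiH_le (hm₁ : Tendsto (fun n : ℕ => (m₁ n : ℝ) / n) atTop (𝓝 α₁))
    (hm₂ : Tendsto (fun n : ℕ => (m₂ n : ℝ) / n) atTop (𝓝 α₂))
    (hAB : ∀ n, IsStdGaussianPair (P n) (A n) (B n)) {γ : ℝ} (hγ : γ < α₁ + α₂ / 2)
    (hγ1 : γ < 1) :
    Tendsto (fun n => (P n).real
      {ω | c n ≠ 0 ∧ xiH (fgl (c n)) (A n ω) (B n ω) ≤ -√(1 - γ) * ‖c n‖}) atTop (𝓝 0) := by
  -- The gap between `γ` and the limit is split at `β`: one part absorbs the fluctuation of `|S|`,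
  -- the other that of the residual norm.
  obtain ⟨β, hγβ, hβ⟩ := exists_between (lt_min hγ hγ1)
  have hβα := hβ.trans_le (min_le_left _ _)
  have hβ1 := hβ.trans_le (min_le_right _ _)
  have hlim := (tendsto_binomial_tail_bound hm₁ hm₂ hβα.ne).add (tendsto_chebyshev_bound (β - γ))
  rw [add_zero] at hlim
  refine squeeze_zero' (Eventually.of_forall fun _ => measureReal_nonneg) ?_ hlim
  filter_upwards [eventually_mul_lt hm₁ hm₂ hβα, eventually_gt_atTop 0] with n hlt hn
  by_cases hc : c n = 0
  · simp only [hc, ne_eq, not_true_eq_false, false_and, Set.ofPred_false, measureReal_empty]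
    positivity
  · simpa only [ne_eq, hc, not_false_eq_true, true_and] using
      measureReal_xiH_le (hAB n) hn hc hγβ hβ1.le hlt

theorem tendsto_measureReal_xiH_neg (hm₁ : Tendsto (fun n : ℕ => (m₁ n : ℝ) / n) atTop (𝓝 α₁))
    (hm₂ : Tendsto (fun n : ℕ => (m₂ n : ℝ) / n) atTop (𝓝 α₂))
    (hAB : ∀ n, IsStdGaussianPair (P n) (A n) (B n)) (hα : 1 < α₁ + α₂ / 2) :
    Tendsto (fun n => (P n).real {ω | xiH (fgl (c n)) (A n ω) (B n ω) < 0}) atTop (𝓝 0) := by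
  have hlim := tendsto_binomial_tail_bound hm₁ hm₂ hα.ne
  refine squeeze_zero' (Eventually.of_forall fun _ => measureReal_nonneg) ?_ hlim
  filter_upwards [eventually_mul_lt hm₁ hm₂ hα] with n hlt
  rw [one_mul] at hlt ⊢
  exact measureReal_xiH_neg (hAB n) (c n) hlt

theorem tendsto_measureReal_le_xiH (hm₁ : Tendsto (fun n : ℕ => (m₁ n : ℝ) / n) atTop (𝓝 α₁))
    (hm₂ : Tendsto (fun n : ℕ => (m₂ n : ℝ) / n) atTop (𝓝 α₂))
    (hAB : ∀ n, IsStdGaussianPair (P n) (A n) (B n)) {γ : ℝ} (hγ : α₁ + α₂ / 2 < γ)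
    (hγ1 : γ ≤ 1) :
    Tendsto (fun n => (P n).real
      {ω | c n ≠ 0 ∧ -√(1 - γ) * ‖c n‖ ≤ xiH (fgl (c n)) (A n ω) (B n ω)}) atTop (𝓝 0) := by
  obtain ⟨β, hβα, hβγ⟩ := exists_between hγ
  have hlim := (tendsto_binomial_tail_bound hm₁ hm₂ hβα.ne').add (tendsto_chebyshev_bound (γ - β))
  rw [add_zero] at hlim
  refine squeeze_zero' (Eventually.of_forall fun _ => measureReal_nonneg) ?_ hlim
  filter_upwards [eventually_lt_mul hm₁ hm₂ hβα, eventually_gt_atTop 0] with n hlt hn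
  by_cases hc : c n = 0
  · simp only [hc, ne_eq, not_true_eq_false, false_and, Set.ofPred_false, measureReal_empty]
    positivity
  · have := measureReal_le_xiH (hAB n) hn hc hβγ hγ1 hlt
    rw [sub_sq_comm] at this
    simpa only [ne_eq, hc, not_false_eq_true, true_and] using this

/-- Subadditivity alone gives the lower bound, so none of the events has to be measurable. -/
theorem tendsto_measure_one_of_compl_subset
    {good bad₁ bad₂ : ∀ n, Set (Ω n)}
    (hsub : ∀ᶠ n in atTop, (good n)ᶜ ⊆ bad₁ n ∪ bad₂ n)
    (h₁ : Tendsto (fun n => (P n).real (bad₁ n)) atTop (𝓝 0))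
    (h₂ : Tendsto (fun n => (P n).real (bad₂ n)) atTop (𝓝 0)) :
    Tendsto (fun n => P n (good n)) atTop (𝓝 1) := by
  have hreal : Tendsto (fun n => (P n).real (good n)) atTop (𝓝 1) := by
    have hlow : Tendsto (fun n => 1 - ((P n).real (bad₁ n) + (P n).real (bad₂ n))) atTop
        (𝓝 1) := by
      simpa using (h₁.add h₂).const_sub 1
    refine tendsto_of_tendsto_of_tendsto_of_le_of_le' hlow tendsto_const_nhds ?_
      (Eventually.of_forall fun n => measureReal_le_one)
    filter_upwards [hsub] with n hn
    have h1 : (1 : ℝ) ≤ (P n).real (good n) + (P n).real (good n)ᶜ := by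
      have := measureReal_union_le (μ := P n) (good n) (good n)ᶜ
      rwa [Set.union_compl_self, probReal_univ] at this
    have h2 := (measureReal_mono (μ := P n) hn).trans (measureReal_union_le _ _)
    linarith
  have := (ENNReal.continuous_ofReal.tendsto 1).comp hreal
  rw [ENNReal.ofReal_one] at this
  refine this.congr fun n => ?_
  exact ofReal_measureReal

end Limits

/-! ### The thresholds in terms of `‖c‖` -/

section Thresholds

variable {α₁ α₂ ε₁ ε₅ : ℝ} {n : ℕ}

theorem Cgl_mul_xiDl (hn : 0 < n) (c : EuclideanSpace ℝ (Fin n))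
    (h : sqrtDl α₁ α₂ ε₁ ε₅ ^ 2 ≤ 1) :
    Cgl c * xiDl α₁ α₂ ε₁ ε₅ n = -√(1 - sqrtDl α₁ α₂ ε₁ ε₅ ^ 2) * ‖c‖ := by
  have : √(n : ℝ) ≠ 0 := by positivity
  rw [Cgl, xiDl, if_pos h]
  field_simp

theorem Cgl_mul_xiDl_nonpos (c : EuclideanSpace ℝ (Fin n)) :
    Cgl c * xiDl α₁ α₂ ε₁ ε₅ n ≤ 0 := by
  have h1 : 0 ≤ Cgl c := by unfold Cgl; positivity
  refine mul_nonpos_of_nonneg_of_nonpos h1 ?_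
  unfold xiDl
  split_ifs
  · rw [neg_mul, neg_nonpos]; positivity
  · rfl

/-- Capping at 1 merges the two branches of the threshold, giving a value `γ ≤ 1` that fits the
upper tail estimate. -/
theorem Cgl_mul_xiDu (hn : 0 < n) (c : EuclideanSpace ℝ (Fin n)) :
    Cgl c * xiDu α₁ α₂ ε₁ ε₅ n = -√(1 - min 1 (sqrtDu α₁ α₂ ε₁ ε₅ ^ 2)) * ‖c‖ := by
  have : √(n : ℝ) ≠ 0 := by positivity
  rw [Cgl, xiDu]
  split_ifs with h
  · rw [min_eq_right h]
    field_simp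
  · rw [min_eq_left (not_le.1 h).le]
    simp

theorem sqrtDl_sq_lt (hε₁ : 0 < ε₁) (hε₅ : 0 < ε₅) (h : 0 ≤ sqrtDl α₁ α₂ ε₁ ε₅) :
    sqrtDl α₁ α₂ ε₁ ε₅ ^ 2 < α₁ + α₂ / 2 := by
  have hs : 0 ≤ √(α₁ + α₂ / 2) := Real.sqrt_nonneg _
  have hlt : sqrtDl α₁ α₂ ε₁ ε₅ < √(α₁ + α₂ / 2) := by
    unfold sqrtDl
    nlinarith
  exact (Real.lt_sqrt h).1 hlt

theorem lt_sqrtDu_sq (hε₁ : 0 < ε₁) (hε₅ : 0 < ε₅) :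
    α₁ + α₂ / 2 < sqrtDu α₁ α₂ ε₁ ε₅ ^ 2 := by
  have hs : 0 ≤ √(α₁ + α₂ / 2) := Real.sqrt_nonneg _
  have hlt : √(α₁ + α₂ / 2) < sqrtDu α₁ α₂ ε₁ ε₅ := by
    unfold sqrtDu
    nlinarith
  exact (Real.sqrt_lt' (hs.trans_lt hlt)).1 hlt

end Thresholds

end RandomProgram

/-! ### The main theorem -/

theorem mainTheorem4
    (α₁ α₂ ε₁ ε₅ : ℝ) (hε₁ : 0 < ε₁) (hε₅ : 0 < ε₅)
    -- the constants `ε₁`, `ε₅` are small: `√D⁽ˡ⁾` is a genuine (non-negative) square root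
    (hsmall : 0 ≤ RandomProgram.sqrtDl α₁ α₂ ε₁ ε₅)
    -- linear regime
    (m₁ m₂ : ℕ → ℕ)
    (hm₁ : Tendsto (fun n : ℕ => (m₁ n : ℝ) / n) atTop (𝓝 α₁))
    (hm₂ : Tendsto (fun n : ℕ => (m₂ n : ℝ) / n) atTop (𝓝 α₂))
    -- deterministic cost vectors with bounded `C_gl`
    (c : ∀ n : ℕ, EuclideanSpace ℝ (Fin n))
    (hc : ∃ K : ℝ, ∀ n, RandomProgram.Cgl (c n) ≤ K)
    -- Gaussian matrices
    {Ω : ℕ → Type*} [∀ n, MeasurableSpace (Ω n)]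
    (P : ∀ n, Measure (Ω n)) [∀ n, IsProbabilityMeasure (P n)]
    (A : ∀ n, Ω n → Matrix (Fin (m₁ n)) (Fin n) ℝ)
    (B : ∀ n, Ω n → Matrix (Fin (m₂ n)) (Fin n) ℝ)
    (hAB : ∀ n, RandomProgram.IsStdGaussianPair (P n) (A n) (B n)) :
    (α₁ + α₂ / 2 < 1 → (∀ᶠ n in atTop, c n ≠ 0) →
      Tendsto (fun n : ℕ => P n {ω |
          RandomProgram.Cgl (c n) * RandomProgram.xiDl α₁ α₂ ε₁ ε₅ n <
            RandomProgram.xiH (RandomProgram.fgl (c n)) (A n ω) (B n ω) ∧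
          RandomProgram.xiH (RandomProgram.fgl (c n)) (A n ω) (B n ω) <
            RandomProgram.Cgl (c n) * RandomProgram.xiDu α₁ α₂ ε₁ ε₅ n})
        atTop (𝓝 1)) ∧
    Tendsto (fun n : ℕ => P n {ω |
        RandomProgram.Cgl (c n) * RandomProgram.xiDl α₁ α₂ ε₁ ε₅ n ≤
          RandomProgram.xiH (RandomProgram.fgl (c n)) (A n ω) (B n ω) ∧
        RandomProgram.xiH (RandomProgram.fgl (c n)) (A n ω) (B n ω) ≤
          RandomProgram.Cgl (c n) * RandomProgram.xiDu α₁ α₂ ε₁ ε₅ n})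
      atTop (𝓝 1) := by
  open RandomProgram in
  have hdl := sqrtDl_sq_lt hε₁ hε₅ hsmall
  have hdu := lt_sqrtDu_sq (α₁ := α₁) (α₂ := α₂) hε₁ hε₅
  refine ⟨fun hα hc0 => ?_, ?_⟩
  · refine tendsto_measure_one_of_compl_subset ?_
      (tendsto_measureReal_xiH_le (c := c) hm₁ hm₂ hAB hdl (hdl.trans hα))
      (tendsto_measureReal_le_xiH (c := c) hm₁ hm₂ hAB (lt_min hα hdu) (min_le_left _ _))
    filter_upwards [hc0, eventually_gt_atTop 0] with n hcn hn ω hω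
    rw [Cgl_mul_xiDl hn _ (hdl.trans hα).le, Cgl_mul_xiDu hn] at hω
    by_contra hbad
    refine hω ⟨?_, ?_⟩
    · exact not_le.1 fun h => hbad (Or.inl ⟨hcn, h⟩)
    · exact not_le.1 fun h => hbad (Or.inr ⟨hcn, h⟩)
  · have hlow : ∃ bad : ∀ n, Set (Ω n), Tendsto (fun n => (P n).real (bad n)) atTop (𝓝 0) ∧
        ∀ᶠ n in atTop, ∀ ω ∉ bad n, Cgl (c n) * xiDl α₁ α₂ ε₁ ε₅ n ≤
          xiH (fgl (c n)) (A n ω) (B n ω) := by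
      -- The critical case `α = 1` belongs to the first branch: there the lower threshold still has
      -- `d_l² < α ≤ 1`. The vanishing estimate needs `α > 1` strictly.
      rcases le_or_gt (α₁ + α₂ / 2) 1 with hα | hα
      · refine ⟨_, tendsto_measureReal_xiH_le (c := c) hm₁ hm₂ hAB hdl (hdl.trans_le hα), ?_⟩
        filter_upwards [eventually_gt_atTop 0] with n hn ω hω
        by_cases hcn : c n = 0
        · rw [hcn, xiH_zero]; exact Cgl_mul_xiDl_nonpos _
        · rw [Cgl_mul_xiDl hn _ (hdl.trans_le hα).le]
          by_contra hlt
          exact hω ⟨hcn, (not_le.1 hlt).le⟩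
      · refine ⟨_, tendsto_measureReal_xiH_neg (c := c) hm₁ hm₂ hAB hα, ?_⟩
        filter_upwards with n ω hω
        exact (Cgl_mul_xiDl_nonpos _).trans (not_lt.1 hω)
    have hup : ∃ bad : ∀ n, Set (Ω n), Tendsto (fun n => (P n).real (bad n)) atTop (𝓝 0) ∧
        ∀ᶠ n in atTop, ∀ ω ∉ bad n, xiH (fgl (c n)) (A n ω) (B n ω) ≤
          Cgl (c n) * xiDu α₁ α₂ ε₁ ε₅ n := by
      rcases lt_or_ge (α₁ + α₂ / 2) 1 with hα | hα
      · refine ⟨_, tendsto_measureReal_le_xiH (c := c) hm₁ hm₂ hAB (lt_min hα hdu)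
          (min_le_left _ _), ?_⟩
        filter_upwards [eventually_gt_atTop 0] with n hn ω hω
        by_cases hcn : c n = 0
        · rw [hcn, xiH_zero]; simp [Cgl]
        · rw [Cgl_mul_xiDu hn]
          by_contra hlt
          exact hω ⟨hcn, (not_le.1 hlt).le⟩
      -- For `α ≥ 1` one has `d_u² > 1`, so the upper threshold is zero and the bound holds surely
      -- for every `n > 0`.
      · refine ⟨fun _ => ∅, by simp, ?_⟩
        filter_upwards [eventually_gt_atTop 0] with n hn ω _
        rw [Cgl_mul_xiDu hn, min_eq_left (hα.trans_lt hdu).le]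
        simpa using xiH_nonpos (c n) (A n ω) (B n ω)
    obtain ⟨bad₁, hbad₁, h₁⟩ := hlow
    obtain ⟨bad₂, hbad₂, h₂⟩ := hup
    refine tendsto_measure_one_of_compl_subset ?_ hbad₁ hbad₂
    filter_upwards [h₁, h₂] with n h₁ h₂ ω hω
    by_contra hbad
    exact hω ⟨h₁ ω fun h => hbad (Or.inl h), h₂ ω fun h => hbad (Or.inr h)⟩
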